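/- **Setting.** Let $\Lambda\in C^\infty(\mathbb R^n)$ be a positive weight function with polynomial growth: there are constants $0<\mu_0\le\mu_1$ and $0<C_0\le C_1$ with $C_0(1+|\xi|)^{\mu_0}\le\Lambda(\xi)\le C_1(1+|\xi|)^{\mu_1}$ for all $\xi\in\mathbb R^n$, and there is a real $\mu\ge\mu_1$ such that for all multi-indices $\alpha$ and all $\gamma\in\{0,1\}^n$ there is a constant $C_{\alpha,\gamma}>0$ with $$|\xi^\gamma(\partial^{\alpha+\gamma}\Lambda)(\xi)|\le C_{\alpha,\gamma}\,\Lambda(\xi)^{1-|\alpha|/\mu},\qquad \xi\in\mathbb R^n.$$ Let $\rho\in(0,1/\mu]$. For $m\in\mathbb R$, $S^m_{\rho,\Lambda}$ is the set of all $\sigma\in C^\infty(\mathbb R^n\times\mathbb R^n)$ such that for all multi-indices $\alpha,\beta$ there is a constant $C_{\alpha,\beta}>0$ with $|(\partial_x^\alpha\partial_\xi^\beta\sigma)(x,\xi)|\le C_{\alpha,\beta}\Lambda(\xi)^{m-\rho|\beta|}$ for all $x,\xi\in\mathbb R^n$, and $M^m_{\rho,\Lambda}$ is the set of all $\sigma\in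 C^\infty(\mathbb R^n\times\mathbb R^n)$ such that $\xi^\gamma\partial_\xi^\gamma\sigma\in S^m_{\rho,\Lambda}$ for all $\gamma\in\{0,1\}^n$. A symbol $\sigma\in M^m_{\rho,\Lambda}$ is called $M$-elliptic if there are constants $C,R>0$ with $|\sigma(x,\xi)|\ge C\Lambda(\xi)^m$ for all $x,\xi\in\mathbb R^n$ with $|\xi|\ge R$. For $\sigma\in M^m_{\rho,\Lambda}$ and a Schwartz function $\varphi\in\mathcal S$ put $$(T_\sigma\varphi)(x)=(2\pi)^{-n/2}\int_{\mathbb R^n}e^{ix\cdot\xi}\sigma(x,\xi)\hat\varphi(\xi)\,d\xi,\qquad \hat\varphi(\xi)=(2\pi)^{-n/2}\int_{\mathbb R^n}e^{-ix\cdot\xi}\varphi(x)\,dx,$$ and extend $T_\sigma$ to tempered distributions $u\in\mathcal S'$ by $(T_\sigma u)(\varphi)=u\big(\overline{T_\sigma^*\overline\varphi}\big)$, where $T_\sigma^*:\mathcal S\to\mathcal S$ is the formal adjoint, i.e. $\int (T_\sigma\varphi)\overline\psi\,dx=\int\varphi\,\overline{T_\sigma^*\psi}\,dx$ for $\varphi,\psi\in\mathcal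 S$. For $s\in\mathbb R$ let $J_s$ be the operator on $\mathcal S'$ with symbol $\Lambda(\xi)^{-s}$, and for $1<p<\infty$ let $H^{s,p}_\Lambda=\{u\in\mathcal S':J_{-s}u\in L^p(\mathbb R^n)\}$ with norm $\|u\|_{s,p,\Lambda}=\|J_{-s}u\|_{L^p(\mathbb R^n)}$. **Theorem.** Let $1<p<\infty$, $m\in\mathbb R$ and $\sigma\in M^m_{\rho,\Lambda}$. If, for some $s\in\mathbb R$, the operator $T_\sigma:H^{s,p}_\Lambda\to H^{s-m,p}_\Lambda$ is a (bounded) Fredholm operator, then $\sigma$ is $M$-elliptic. -/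

import Mathlib

open scoped SchwartzMap ContDiff ENNReal ComplexConjugate FourierTransform

noncomputable section

namespace MPseudo

/-- The Euclidean space `ℝⁿ`. -/
abbrev Euc (n : ℕ) : Type := EuclideanSpace ℝ (Fin n)

/-! ### Partial derivatives and multi-indices -/

section Derivatives

variable {n : ℕ} {F : Type*} [NormedAddCommGroup F] [NormedSpace ℝ F]

/-- The partial derivative `∂ᵢ f`. -/
def partialDeriv (i : Fin n) (f : Euc n → F) : Euc n → F :=
  fun x => fderiv ℝ f x (EuclideanSpace.single i 1)

/-- `∂^α f = ∂₁^{α₁} ⋯ ∂ₙ^{αₙ} f` for a multi-index `α`. -/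
def multiDeriv (α : Fin n → ℕ) (f : Euc n → F) : Euc n → F :=
  (List.finRange n).foldr (fun i g => (partialDeriv i)^[α i] g) f

/-- The length `|α| = α₁ + ⋯ + αₙ` of a multi-index. -/
def multiLength (α : Fin n → ℕ) : ℕ := ∑ i, α i

/-- The monomial `ξ^γ = ξ₁^{γ₁} ⋯ ξₙ^{γₙ}`. -/
def monomial (γ : Fin n → ℕ) (ξ : Euc n) : ℝ := ∏ i, ξ i ^ γ i

end Derivatives

/-! ### Weight functions -/

/-- A weight function with polynomial growth on `ℝⁿ`, together with a real constant `μ` for which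
the derivative estimates hold. -/
structure WeightFunction (n : ℕ) where
  /-- the weight function itself -/
  toFun : Euc n → ℝ
  /-- the constant `μ` in the derivative estimates -/
  μ : ℝ
  smooth : ContDiff ℝ ∞ toFun
  pos : ∀ ξ, 0 < toFun ξ
  growth : ∃ μ₀ μ₁ C₀ C₁ : ℝ, 0 < μ₀ ∧ μ₀ ≤ μ₁ ∧ 0 < C₀ ∧ C₀ ≤ C₁ ∧ μ₁ ≤ μ ∧
    ∀ ξ, C₀ * (1 + ‖ξ‖) ^ μ₀ ≤ toFun ξ ∧ toFun ξ ≤ C₁ * (1 + ‖ξ‖) ^ μ₁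
  deriv_bound : ∀ α γ : Fin n → ℕ, (∀ j, γ j = 0 ∨ γ j = 1) → ∃ C : ℝ, 0 < C ∧ ∀ ξ,
    |monomial γ ξ * multiDeriv (α + γ) toFun ξ| ≤ C * toFun ξ ^ (1 - 1 / μ * (multiLength α : ℝ))

instance (n : ℕ) : CoeFun (WeightFunction n) (fun _ => Euc n → ℝ) := ⟨WeightFunction.toFun⟩

/-! ### Symbol classes -/

/-- The symbol class `S^m_{ρ,Λ}`. -/
def IsSymbolS {n : ℕ} (Λ : WeightFunction n) (ρ m : ℝ) (σ : Euc n → Euc n → ℂ) : Prop :=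
  ContDiff ℝ ∞ (fun z : Euc n × Euc n => σ z.1 z.2) ∧
  ∀ α β : Fin n → ℕ, ∃ C : ℝ, 0 < C ∧ ∀ x ξ,
    ‖multiDeriv α (fun y => multiDeriv β (σ y) ξ) x‖ ≤ C * Λ ξ ^ (m - ρ * (multiLength β : ℝ))

/-- The symbol class `M^m_{ρ,Λ}`: `ξ^γ ∂_ξ^γ σ ∈ S^m_{ρ,Λ}` for all `γ ∈ {0,1}ⁿ`. -/
def IsSymbolM {n : ℕ} (Λ : WeightFunction n) (ρ m : ℝ) (σ : Euc n → Euc n → ℂ) : Prop :=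
  ContDiff ℝ ∞ (fun z : Euc n × Euc n => σ z.1 z.2) ∧
  ∀ γ : Fin n → ℕ, (∀ j, γ j = 0 ∨ γ j = 1) →
    IsSymbolS Λ ρ m (fun x ξ => (monomial γ ξ : ℂ) * multiDeriv γ (σ x) ξ)

/-- `M`-ellipticity of a symbol of order `m`. -/
def IsMElliptic {n : ℕ} (Λ : WeightFunction n) (m : ℝ) (σ : Euc n → Euc n → ℂ) : Prop :=
  ∃ C R : ℝ, 0 < C ∧ 0 < R ∧ ∀ x ξ : Euc n, R ≤ ‖ξ‖ → C * Λ ξ ^ m ≤ ‖σ x ξ‖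

/-! ### Pseudo-differential operators -/

/-- The Fourier transform `φ̂(ξ) = (2π)^{-n/2} ∫ e^{-i x·ξ} φ(x) dx`. -/
def fourierHat {n : ℕ} (φ : Euc n → ℂ) (ξ : Euc n) : ℂ :=
  (((2 * Real.pi) ^ (-(n : ℝ) / 2) : ℝ) : ℂ) *
    ∫ x : Euc n, Complex.exp (-Complex.I * (inner ℝ x ξ : ℝ)) * φ x

/-- The pseudo-differential operator `T_σ` on Schwartz functions,
`(T_σ φ)(x) = (2π)^{-n/2} ∫ e^{i x·ξ} σ(x,ξ) φ̂(ξ) dξ`. -/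
def pseudoDiff {n : ℕ} (σ : Euc n → Euc n → ℂ) (φ : 𝓢(Euc n, ℂ)) (x : Euc n) : ℂ :=
  (((2 * Real.pi) ^ (-(n : ℝ) / 2) : ℝ) : ℂ) *
    ∫ ξ : Euc n, Complex.exp (Complex.I * (inner ℝ x ξ : ℝ)) * σ x ξ * fourierHat φ ξ

/-- `χ` is the value at `ψ` of the formal adjoint of `T_σ`: `(T_σ φ, ψ) = (φ, χ)` for every Schwartz
function `φ`, where `(f, g) = ∫ f ḡ`. -/
def IsFormalAdjointAt {n : ℕ} (σ : Euc n → Euc n → ℂ) (ψ χ : 𝓢(Euc n, ℂ)) : Prop :=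
  ∀ φ : 𝓢(Euc n, ℂ),
    ∫ x : Euc n, pseudoDiff σ φ x * conj (ψ x) = ∫ x : Euc n, φ x * conj (χ x)

open Classical in
/-- The formal adjoint `T_σ^*` on the Schwartz space. For a symbol of one of the classes above the
function `χ` exists for every `ψ`, and it is always unique; the value `0` in the other case is never
used. -/
def formalAdjoint {n : ℕ} (σ : Euc n → Euc n → ℂ) (ψ : 𝓢(Euc n, ℂ)) : 𝓢(Euc n, ℂ) :=
  if h : ∃ χ, IsFormalAdjointAt σ ψ χ then h.choose else 0

/-- Complex conjugation of a Schwartz function. -/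
def schwartzConj {n : ℕ} (φ : 𝓢(Euc n, ℂ)) : 𝓢(Euc n, ℂ) :=
  SchwartzMap.postcompCLM (𝕜 := ℝ) (Complex.conjCLE : ℂ →L[ℝ] ℂ) φ

/-- The extension of `T_σ` to tempered distributions: `(T_σ u)(φ) = u(conj (T_σ^* (conj φ)))`. -/
def pseudoDiffDist {n : ℕ} (σ : Euc n → Euc n → ℂ) (u : 𝓢'(Euc n, ℂ)) (φ : 𝓢(Euc n, ℂ)) : ℂ :=
  u (schwartzConj (formalAdjoint σ (schwartzConj φ)))

/-! ### Powers of a weight function have temperate growth -/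

section TemperateGrowth

variable {n : ℕ}

/-- Iterated partial derivatives along a list of coordinate directions. -/
def listDeriv (l : List (Fin n)) (f : Euc n → ℝ) : Euc n → ℝ := l.foldr partialDeriv f

theorem contDiff_partialDeriv {f : Euc n → ℝ} (hf : ContDiff ℝ ∞ f) (i : Fin n) :
    ContDiff ℝ ∞ (partialDeriv i f) :=
  (hf.fderiv_right (m := ∞) (by simp)).clm_apply contDiff_const

theorem contDiff_listDeriv {f : Euc n → ℝ} (hf : ContDiff ℝ ∞ f) (l : List (Fin n)) :
    ContDiff ℝ ∞ (listDeriv l f) := by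
  induction l with
  | nil => exact hf
  | cons i l ih => exact contDiff_partialDeriv ih i

theorem partialDeriv_comm {f : Euc n → ℝ} (hf : ContDiff ℝ ∞ f) (i j : Fin n) :
    partialDeriv i (partialDeriv j f) = partialDeriv j (partialDeriv i f) := by
  have key : ∀ (i j : Fin n) (x : Euc n), partialDeriv i (partialDeriv j f) x =
      fderiv ℝ (fderiv ℝ f) x (EuclideanSpace.single i 1) (EuclideanSpace.single j 1) := by
    intro i j x
    have h : DifferentiableAt ℝ (fderiv ℝ f) x :=
      ((hf.fderiv_right (m := ∞) (by simp)).differentiable (by simp)).differentiableAt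
    change fderiv ℝ (fun y => fderiv ℝ f y (EuclideanSpace.single j 1)) x _ = _
    rw [fderiv_clm_apply h (differentiableAt_const _)]
    simp
  ext x
  rw [key, key]
  exact (hf.contDiffAt.isSymmSndFDerivAt (by simpa using WithTop.coe_le_coe.2 (le_top : (2 : ℕ∞) ≤ ⊤))) _ _

theorem listDeriv_perm {f : Euc n → ℝ} (hf : ContDiff ℝ ∞ f) {l l' : List (Fin n)}
    (h : l.Perm l') : listDeriv l f = listDeriv l' f := by
  induction h with
  | nil => rfl
  | cons i _ ih => exact congrArg (partialDeriv i) ih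
  | swap i j l => exact partialDeriv_comm (contDiff_listDeriv hf l) j i
  | trans _ _ h₁ h₂ => exact h₁.trans h₂

theorem multiDeriv_eq_listDeriv (α : Fin n → ℕ) (f : Euc n → ℝ) :
    multiDeriv α f = listDeriv ((List.finRange n).flatMap fun i => List.replicate (α i) i) f := by
  unfold multiDeriv listDeriv
  induction List.finRange n with
  | nil => rfl
  | cons i l ih =>
    rw [List.flatMap_cons, List.foldr_append, ← ih, List.foldr_cons]
    generalize l.foldr (fun i g => (partialDeriv i)^[α i] g) f = g
    induction α i with
    | zero => rfl
    | succ k ihk => rw [Function.iterate_succ_apply', ihk, List.replicate_succ, List.foldr_cons]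

theorem listDeriv_eq_multiDeriv {f : Euc n → ℝ} (hf : ContDiff ℝ ∞ f) (l : List (Fin n)) :
    listDeriv l f = multiDeriv (fun i => l.count i) f := by
  rw [multiDeriv_eq_listDeriv]
  apply listDeriv_perm hf
  rw [List.perm_iff_count]
  intro a
  simp only [List.count_flatMap, Function.comp_def, List.count_replicate]
  rw [← List.ofFn_eq_map, List.sum_ofFn]
  simp

theorem iteratedFDeriv_apply_single {f : Euc n → ℝ} (hf : ContDiff ℝ ∞ f) (k : ℕ)
    (J : Fin k → Fin n) (x : Euc n) :
    iteratedFDeriv ℝ k f x (fun j => EuclideanSpace.single (J j) 1) =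
      listDeriv (List.ofFn J) f x := by
  induction k generalizing x with
  | zero => simp [listDeriv]
  | succ k ih =>
    have hd : DifferentiableAt ℝ (iteratedFDeriv ℝ k f) x :=
      (hf.differentiable_iteratedFDeriv (by exact_mod_cast WithTop.coe_lt_top _)).differentiableAt
    rw [hd.iteratedFDeriv_succ_apply_left', List.ofFn_succ]
    change _ = partialDeriv (J 0) (listDeriv _ f) x
    rw [partialDeriv]
    congr 2
    ext y
    exact ih (fun j => J j.succ) y

theorem norm_multilinear_le {k : ℕ} (A : ContinuousMultilinearMap ℝ (fun _ : Fin k => Euc n) ℝ) :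
    ‖A‖ ≤ ∑ J : Fin k → Fin n, ‖A (fun j => EuclideanSpace.single (J j) 1)‖ := by
  refine A.opNorm_le_bound (by positivity) fun v => ?_
  have hv : v = fun j => ∑ i, v j i • EuclideanSpace.single i (1 : ℝ) := by
    ext j i
    simp [Finset.sum_apply, Pi.single_apply]
  have hA : A v = ∑ J : Fin k → Fin n, (∏ j, v j (J j)) •
      A (fun j => EuclideanSpace.single (J j) 1) := by
    conv_lhs => rw [hv]
    rw [A.map_sum]
    exact Finset.sum_congr rfl fun J _ => A.map_smul_univ _ _
  rw [hA, Finset.sum_mul]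
  refine (norm_sum_le _ _).trans (Finset.sum_le_sum fun J _ => ?_)
  rw [norm_smul, mul_comm, norm_prod]
  gcongr with j
  exact PiLp.norm_apply_le (v j) (J j)

theorem hasTemperateGrowth_of_listDeriv {f : Euc n → ℝ} (hf : ContDiff ℝ ∞ f) (s : ℕ → ℕ)
    (h : ∀ l : List (Fin n), ∃ C : ℝ, ∀ x, ‖listDeriv l f x‖ ≤ C * (1 + ‖x‖) ^ s l.length) :
    f.HasTemperateGrowth := by
  refine ⟨hf, fun k => ?_⟩
  choose C hC using h
  refine ⟨s k, ∑ J : Fin k → Fin n, C (List.ofFn J), fun x => ?_⟩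
  refine (norm_multilinear_le _).trans ?_
  rw [Finset.sum_mul]
  refine Finset.sum_le_sum fun J _ => ?_
  rw [iteratedFDeriv_apply_single hf]
  simpa using hC (List.ofFn J) x

theorem rpow_le_one_add_pow {a C r : ℝ} {x : ℝ} (hx : 0 ≤ x) (ha : 0 < a) (hC : 0 < C)
    (h : a ≤ C * (1 + x) ^ r) (t : ℝ) (ht : 0 ≤ t) :
    a ^ t ≤ C ^ t * (1 + x) ^ ⌈r * t⌉₊ := by
  calc a ^ t ≤ (C * (1 + x) ^ r) ^ t := Real.rpow_le_rpow ha.le h ht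
    _ = C ^ t * (1 + x) ^ (r * t) := by
      rw [Real.mul_rpow hC.le (by positivity), ← Real.rpow_mul (by positivity)]
    _ ≤ C ^ t * (1 + x) ^ ⌈r * t⌉₊ := by
      gcongr
      rw [← Real.rpow_natCast]
      exact Real.rpow_le_rpow_of_exponent_le (by linarith) (Nat.le_ceil _)

theorem rpow_le_of_lower {a c : ℝ} (hc : 0 < c) (hca : c ≤ a) (t : ℝ) (ht : t ≤ 0) :
    a ^ t ≤ c ^ t := Real.rpow_le_rpow_of_nonpos hc hca ht

theorem WeightFunction.exists_lower (Λ : WeightFunction n) : ∃ c : ℝ, 0 < c ∧ ∀ ξ, c ≤ Λ ξ := by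
  obtain ⟨μ₀, μ₁, C₀, C₁, h0, h01, hC0, hC01, hμ, h⟩ := Λ.growth
  refine ⟨C₀, hC0, fun ξ => le_trans ?_ (h ξ).1⟩
  exact le_mul_of_one_le_right hC0.le (Real.one_le_rpow (by simp) h0.le)

theorem WeightFunction.hasTemperateGrowth (Λ : WeightFunction n) :
    Function.HasTemperateGrowth (Λ : Euc n → ℝ) := by
  obtain ⟨c, hc, hlow⟩ := Λ.exists_lower
  obtain ⟨μ₀, μ₁, C₀, C₁, h0, h01, hC0, hC01, hμ, h⟩ := Λ.growth
  have hC1 : 0 < C₁ := hC0.trans_le hC01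
  refine hasTemperateGrowth_of_listDeriv Λ.smooth
    (fun k => ⌈μ₁ * max (1 - 1 / Λ.μ * (k : ℝ)) 0⌉₊) fun l => ?_
  obtain ⟨C, hC, hb⟩ := Λ.deriv_bound (fun i => l.count i) 0 (by simp)
  have hlen : multiLength (fun i => l.count i) = l.length := by
    rw [multiLength, ← List.sum_toFinset_count_eq_length l]
    refine (Finset.sum_subset (Finset.subset_univ _) fun i _ hi => ?_).symm
    exact List.count_eq_zero.2 fun h => hi (List.mem_toFinset.2 h)
  set t : ℝ := 1 - 1 / Λ.μ * (l.length : ℝ) with ht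
  refine ⟨C * (C₁ ^ max t 0 + c ^ min t 0), fun x => ?_⟩
  have hx := hb x
  rw [hlen, ← ht, add_zero, ← listDeriv_eq_multiDeriv Λ.smooth] at hx
  simp only [monomial, Pi.zero_apply, pow_zero, Finset.prod_const_one, one_mul] at hx
  rw [Real.norm_eq_abs, mul_assoc]
  refine hx.trans (mul_le_mul_of_nonneg_left ?_ hC.le)
  have h1 : 1 ≤ (1 + ‖x‖) ^ ⌈μ₁ * max t 0⌉₊ := one_le_pow₀ (by simp)
  rw [add_mul]
  rcases le_total 0 t with h' | h'
  · rw [max_eq_left h']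
    have := rpow_le_one_add_pow (norm_nonneg x) (Λ.pos x) hC1 (h x).2 t h'
    have h2 : 0 ≤ c ^ min t 0 * (1 + ‖x‖) ^ ⌈μ₁ * t⌉₊ := by positivity
    linarith
  · rw [min_eq_left h']
    have h2 := Real.rpow_le_rpow_of_nonpos hc (hlow x) h'
    have h3 : c ^ t ≤ c ^ t * (1 + ‖x‖) ^ ⌈μ₁ * max t 0⌉₊ :=
      le_mul_of_one_le_right (by positivity) h1
    have h4 : 0 ≤ C₁ ^ max t 0 * (1 + ‖x‖) ^ ⌈μ₁ * max t 0⌉₊ := by positivity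
    linarith

/-- The symbol `ξ ↦ Λ(2πξ)^s`: it is `Λ^s` in the normalization of Mathlib's Fourier transform,
whose kernel is `e^{-2πi x·ξ}`. -/
def WeightFunction.rescaledPow (Λ : WeightFunction n) (s : ℝ) (ξ : Euc n) : ℂ :=
  ((Λ ((2 * Real.pi) • ξ) ^ s : ℝ) : ℂ)

theorem hasTemperateGrowth_rpow_comp {f : Euc n → ℝ} (hf : f.HasTemperateGrowth) {c : ℝ}
    (hc : 0 < c) (hlow : ∀ x, c ≤ f x) (s : ℝ) :
    Function.HasTemperateGrowth (fun x => f x ^ s) := by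
  have ho : IsOpen (Set.Ioi (c / 2)) := isOpen_Ioi
  refine Function.HasTemperateGrowth.comp' (t := Set.Ioi (c / 2)) (g := fun y : ℝ => y ^ s)
    (f := f) ?_ ho.uniqueDiffOn ?_ ?_ hf
  · rintro - ⟨y, rfl⟩
    exact lt_of_lt_of_le (by linarith) (hlow y)
  · exact contDiffOn_fun_id.rpow_const_of_ne fun x hx => ne_of_gt (lt_trans (by linarith) hx)
  · intro N
    refine ⟨⌈|s|⌉₊, ∑ k ∈ Finset.range (N + 1),
      ‖Polynomial.eval s (descPochhammer ℝ k)‖ * (1 + (c / 2) ^ (s - k)),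
      by positivity, fun k hk x hx => ?_⟩
    have hx2 : c / 2 < x := hx
    have hx0 : 0 < x := lt_trans (by linarith) hx2
    have hcd : ContDiffAt ℝ k (fun y : ℝ => y ^ s) x := Real.contDiffAt_rpow_const (Or.inl hx0.ne')
    rw [norm_iteratedFDerivWithin_eq_norm_iteratedDerivWithin,
      iteratedDerivWithin_eq_iteratedDeriv ho.uniqueDiffOn hcd hx, iteratedDeriv_eq_iterate,
      Real.iter_deriv_rpow_const, norm_mul]
    have hp : 1 ≤ (1 + ‖x‖) ^ ⌈|s|⌉₊ := one_le_pow₀ (by simp)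
    have hbd : ‖x ^ (s - k)‖ ≤ (1 + (c / 2) ^ (s - k)) * (1 + ‖x‖) ^ ⌈|s|⌉₊ := by
      rw [Real.norm_of_nonneg (by positivity), add_mul, one_mul]
      have e1 : 0 ≤ (c / 2) ^ (s - k) := by positivity
      rcases le_total 0 (s - k) with h' | h'
      · have h1 : x ^ (s - k) ≤ (1 + ‖x‖) ^ (s - k) :=
          Real.rpow_le_rpow hx0.le (by rw [Real.norm_of_nonneg hx0.le]; linarith) h'
        have h2 : (1 + ‖x‖) ^ (s - k) ≤ (1 + ‖x‖) ^ ⌈|s|⌉₊ := by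
          rw [← Real.rpow_natCast]
          refine Real.rpow_le_rpow_of_exponent_le (by simp) ?_
          have := Nat.le_ceil |s|
          have := le_abs_self s
          have : (0 : ℝ) ≤ k := Nat.cast_nonneg k
          linarith
        have h3 : 0 ≤ (c / 2) ^ (s - k) * (1 + ‖x‖) ^ ⌈|s|⌉₊ := by positivity
        linarith
      · have h1 := Real.rpow_le_rpow_of_nonpos (by linarith) hx2.le h'
        have h2 := le_mul_of_one_le_right e1 hp
        linarith
    refine (mul_le_mul_of_nonneg_left hbd (norm_nonneg _)).trans ?_
    rw [← mul_assoc]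
    gcongr
    refine Finset.single_le_sum (f := fun k : ℕ =>
      ‖Polynomial.eval s (descPochhammer ℝ k)‖ * (1 + (c / 2) ^ (s - k)))
      (fun i _ => by positivity) ?_
    exact Finset.mem_range.2 (by omega)

theorem WeightFunction.hasTemperateGrowth_rescaledPow (Λ : WeightFunction n) (s : ℝ) :
    (Λ.rescaledPow s).HasTemperateGrowth := by
  obtain ⟨c, hc, hlow⟩ := Λ.exists_lower
  have h1 : Function.HasTemperateGrowth (fun ξ : Euc n => Λ ((2 * Real.pi) • ξ)) :=
    Λ.hasTemperateGrowth.comp (((2 * Real.pi) • ContinuousLinearMap.id ℝ (Euc n)).hasTemperateGrowth)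
  exact Function.Complex.hasTemperateGrowth_ofReal.comp
    (hasTemperateGrowth_rpow_comp h1 hc (fun ξ => hlow _) s)

end TemperateGrowth

/-! ### Weighted Sobolev spaces -/

section Sobolev

open MeasureTheory

variable {n : ℕ}

/-- The operator `J_s` on tempered distributions, with symbol `Λ(ξ)^{-s}`. -/
def besselJ (Λ : WeightFunction n) (s : ℝ) : 𝓢'(Euc n, ℂ) →L[ℂ] 𝓢'(Euc n, ℂ) :=
  TemperedDistribution.fourierMultiplierCLM ℂ (Λ.rescaledPow (-s))

theorem besselJ_besselJ_neg (Λ : WeightFunction n) (s : ℝ) (u : 𝓢'(Euc n, ℂ)) :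
    besselJ Λ s (besselJ Λ (-s) u) = u := by
  unfold besselJ
  rw [TemperedDistribution.fourierMultiplierCLM_fourierMultiplierCLM_apply
    (Λ.hasTemperateGrowth_rescaledPow _) (Λ.hasTemperateGrowth_rescaledPow _)]
  have : Λ.rescaledPow (- -s) * Λ.rescaledPow (-s) = fun _ => (1 : ℂ) := by
    ext ξ
    simp only [Pi.mul_apply, WeightFunction.rescaledPow, neg_neg]
    rw [← Complex.ofReal_mul, ← Real.rpow_add (Λ.pos _)]
    simp
  rw [this]
  simp

/-- The subspace of those tempered distributions that are `L^p` functions. -/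
def lpDistributions (n : ℕ) (p : ℝ≥0∞) [Fact (1 ≤ p)] : Submodule ℂ 𝓢'(Euc n, ℂ) :=
  (Lp.toTemperedDistributionCLM ℂ (volume : Measure (Euc n)) p).range

/-- The weighted Sobolev space `H^{s,p}_Λ = {u ∈ 𝓢' : J_{-s} u ∈ L^p}`. -/
def SobolevSpace (Λ : WeightFunction n) (s : ℝ) (p : ℝ≥0∞) [Fact (1 ≤ p)] : Type :=
  ((lpDistributions n p).comap (besselJ Λ (-s)).toLinearMap : Submodule ℂ 𝓢'(Euc n, ℂ))

namespace SobolevSpace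

variable (Λ : WeightFunction n) (s : ℝ) (p : ℝ≥0∞) [Fact (1 ≤ p)]

instance : AddCommGroup (SobolevSpace Λ s p) :=
  inferInstanceAs (AddCommGroup
    ((lpDistributions n p).comap (besselJ Λ (-s)).toLinearMap : Submodule ℂ 𝓢'(Euc n, ℂ)))

instance : Module ℂ (SobolevSpace Λ s p) :=
  inferInstanceAs (Module ℂ
    ((lpDistributions n p).comap (besselJ Λ (-s)).toLinearMap : Submodule ℂ 𝓢'(Euc n, ℂ)))

/-- The inclusion of `H^{s,p}_Λ` into the tempered distributions. -/
def toDistribution : SobolevSpace Λ s p →ₗ[ℂ] 𝓢'(Euc n, ℂ) :=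
  ((lpDistributions n p).comap (besselJ Λ (-s)).toLinearMap).subtype

/-- The map `u ↦ J_{-s} u` from `H^{s,p}_Λ` to `L^p`. -/
def toLp : SobolevSpace Λ s p →ₗ[ℂ] Lp ℂ p (volume : Measure (Euc n)) :=
  (LinearEquiv.ofInjective (Lp.toTemperedDistributionCLM ℂ (volume : Measure (Euc n)) p).toLinearMap
    (LinearMap.ker_eq_bot.1 Lp.ker_toTemperedDistributionCLM_eq_bot)).symm.toLinearMap ∘ₗ
  (besselJ Λ (-s)).toLinearMap.restrict (p := (lpDistributions n p).comap
    (besselJ Λ (-s)).toLinearMap) (q := lpDistributions n p) (fun _ h => h)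

/-- `toLp` gives the `L^p` function that represents `J_{-s} u`. -/
theorem toLp_spec (u : SobolevSpace Λ s p) :
    (Lp.toTemperedDistribution (toLp Λ s p u) : 𝓢'(Euc n, ℂ)) =
      besselJ Λ (-s) (toDistribution Λ s p u) := by
  have := (LinearEquiv.ofInjective
    (Lp.toTemperedDistributionCLM ℂ (volume : Measure (Euc n)) p).toLinearMap
    (LinearMap.ker_eq_bot.1 Lp.ker_toTemperedDistributionCLM_eq_bot)).apply_symm_apply
    ((besselJ Λ (-s)).toLinearMap.restrict (p := (lpDistributions n p).comap
    (besselJ Λ (-s)).toLinearMap) (q := lpDistributions n p) (fun _ h => h) u)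
  exact congrArg Subtype.val this

theorem toLp_injective : Function.Injective (toLp Λ s p) := by
  rw [injective_iff_map_eq_zero]
  intro u hu
  have h := toLp_spec Λ s p u
  rw [hu, ← Lp.toTemperedDistributionCLM_apply, map_zero] at h
  have h2 := besselJ_besselJ_neg Λ s (toDistribution Λ s p u)
  rw [← h, map_zero] at h2
  exact Subtype.ext h2.symm

/-- The norm `‖u‖_{s,p,Λ} = ‖J_{-s} u‖_{L^p}`. -/
instance : NormedAddCommGroup (SobolevSpace Λ s p) :=
  NormedAddCommGroup.induced _ _ (toLp Λ s p) (toLp_injective Λ s p)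

instance : NormedSpace ℂ (SobolevSpace Λ s p) :=
  NormedSpace.induced ℂ _ _ (toLp Λ s p)

end SobolevSpace

end Sobolev

/-- The bounded operator `T : H^{s,p}_Λ → H^{t,p}_Λ` is the pseudo-differential operator `T_σ`. -/
def IsPseudoDiffOn {n : ℕ} {Λ : WeightFunction n} {s t : ℝ} {p : ℝ≥0∞} [Fact (1 ≤ p)]
    (σ : Euc n → Euc n → ℂ) (T : SobolevSpace Λ s p →L[ℂ] SobolevSpace Λ t p) : Prop :=
  ∀ (u : SobolevSpace Λ s p) (φ : 𝓢(Euc n, ℂ)),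
    SobolevSpace.toDistribution Λ t p (T u) φ =
      pseudoDiffDist σ (SobolevSpace.toDistribution Λ s p u) φ

end MPseudo

end

/-! The proof tests the operator on wave packets. If `σ` is not elliptic, there are points `(x_k,
ξ_k)` with `Λ(ξ_k) → ∞` and `|σ(x_k, ξ_k)| Λ(ξ_k)^{-m} → 0`. Put `c_k = Λ(ξ_k)^{ρ/2}` and take
functions concentrated near `x_k` at scale `1/c_k` and, in frequency, near `ξ_k` at scale `c_k`. The
symbol varies in `x` at scale `1` and in `ξ` at scale `Λ^ρ = c_k²`, so on such a packet it is
constant up to a relative error of order `1/c_k`, and its normalized value tends to zero.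

The transpose of `T` is applied to the packets. In packet coordinates it becomes an oscillatory
integral whose amplitude has Schwartz bounds uniform in `k` (`pairing_packet`,
`IsAmplitude.exists_schwartz`) and tends to zero pointwise (`packetSymbol_sub_le`,
`tendsto_packetSymbol`). Dominated convergence turns this into smallness in `L^q`, where `q` is the
exponent conjugate to `p` (`exists_small_packets`). The uniformity rests on a Peetre-type inequality
for the weight (`WeightFunction.ratio_rpow_le`).

Normalized in `L^q`, the packets define functionals `φ_k` on the target space with `φ_k → 0`
pointwise (`tendsto_lpPairing_packetOp`) and `φ_k ∘ T → 0` in norm. A Fredholm `T` has a right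
inverse modulo finite rank, which forces `φ_k(y_k) → 0` for every bounded sequence `y_k`
(`tendsto_of_isFredholm`). Taking for `y_k` the conjugate packets, normalized in `L^p`, makes
`φ_k(y_k)` a fixed positive number, a contradiction (`not_tendsto_of_isFredholm`). -/

noncomputable section

namespace MPseudo

open MeasureTheory Filter Topology

/-! ### Families of Schwartz functions with uniform bounds -/

section BoundedFamilies

variable {κ E : Type*} [NormedAddCommGroup E] [NormedSpace ℝ E]

/-- Every Schwartz seminorm of `f i` is bounded by a constant multiple of `w i`. -/
def SchwartzBoundedBy (w : κ → ℝ) (f : κ → 𝓢(E, ℂ)) : Prop :=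
  ∀ k l : ℕ, ∃ C : ℝ, ∀ i, SchwartzMap.seminorm ℂ k l (f i) ≤ C * w i

/-- The functions `a i` are smooth and each of their derivatives is bounded by a constant multiple
of `w i` times a polynomial weight. -/
def TemperateBoundedBy (w : κ → ℝ) (a : κ → E → ℂ) : Prop :=
  (∀ i, ContDiff ℝ ∞ (a i)) ∧
    ∀ j : ℕ, ∃ (N : ℕ) (C : ℝ), ∀ i x, ‖iteratedFDeriv ℝ j (a i) x‖ ≤ C * w i * (1 + ‖x‖) ^ N

theorem seminorm_sum_apply (s : Finset (ℕ × ℕ)) (f : 𝓢(E, ℂ)) :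
    (∑ m ∈ s, schwartzSeminormFamily ℂ E ℂ m) f = ∑ m ∈ s, SchwartzMap.seminorm ℂ m.1 m.2 f := by
  induction s using Finset.cons_induction with
  | empty => rfl
  | cons m s hm ih => rw [Finset.sum_cons, Finset.sum_cons, add_apply, ih]; rfl

theorem SchwartzBoundedBy.const (f : 𝓢(E, ℂ)) :
    SchwartzBoundedBy (fun _ : κ => 1) (fun _ => f) :=
  fun k l => ⟨SchwartzMap.seminorm ℂ k l f, fun _ => by simp⟩

theorem SchwartzBoundedBy.mono {w w' : κ → ℝ} {f : κ → 𝓢(E, ℂ)} (hf : SchwartzBoundedBy w f)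
    (hw : ∀ i, 0 ≤ w i) (h : ∀ i, w i ≤ w' i) : SchwartzBoundedBy w' f := by
  intro k l
  obtain ⟨C, hC⟩ := hf k l
  refine ⟨max C 0, fun i => (hC i).trans ?_⟩
  exact mul_le_mul (le_max_left _ _) (h i) (hw i) (le_max_right _ _)

theorem SchwartzBoundedBy.add {w : κ → ℝ} {f g : κ → 𝓢(E, ℂ)} (hf : SchwartzBoundedBy w f)
    (hg : SchwartzBoundedBy w g) : SchwartzBoundedBy w (fun i => f i + g i) := by
  intro k l
  obtain ⟨C, hC⟩ := hf k l
  obtain ⟨D, hD⟩ := hg k l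
  refine ⟨C + D, fun i => (map_add_le_add _ _ _).trans ?_⟩
  rw [add_mul]
  exact add_le_add (hC i) (hD i)

theorem SchwartzBoundedBy.comp {ι : Type*} {w : κ → ℝ} {f : κ → 𝓢(E, ℂ)}
    (hf : SchwartzBoundedBy w f) (e : ι → κ) :
    SchwartzBoundedBy (fun i => w (e i)) (fun i => f (e i)) := by
  intro k l
  obtain ⟨C, hC⟩ := hf k l
  exact ⟨C, fun i => hC _⟩

/-- Continuity bounds each seminorm of `A f` by a constant times a finite sum of seminorms of `f`,
so the weight `w` passes through unchanged. -/
theorem SchwartzBoundedBy.map {F : Type*} [NormedAddCommGroup F] [NormedSpace ℝ F] {w : κ → ℝ}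
    {f : κ → 𝓢(E, ℂ)} (hf : SchwartzBoundedBy w f) (A : 𝓢(E, ℂ) →L[ℂ] 𝓢(F, ℂ)) :
    SchwartzBoundedBy w (fun i => A (f i)) := by
  intro k l
  have hcont : Continuous ((SchwartzMap.seminorm ℂ k l : Seminorm ℂ 𝓢(F, ℂ)).comp A.toLinearMap) :=
    ((schwartz_withSeminorms ℂ F ℂ).continuous_seminorm (k, l)).comp A.continuous
  obtain ⟨s, C, -, hC⟩ := Seminorm.bound_of_continuous (schwartz_withSeminorms ℂ E ℂ) _ hcont
  choose D hD using hf
  refine ⟨C * ∑ m ∈ s, D m.1 m.2, fun i => (hC (f i)).trans ?_⟩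
  have h1 := Seminorm.finset_sup_le_sum (schwartzSeminormFamily ℂ E ℂ) s (f i)
  rw [mul_assoc, Finset.sum_mul]
  change (C : ℝ) * _ ≤ _
  refine mul_le_mul_of_nonneg_left (h1.trans ?_) C.2
  rw [seminorm_sum_apply]
  exact Finset.sum_le_sum fun m _ => hD m.1 m.2 i

theorem SchwartzBoundedBy.one_add_norm_pow_mul_le {w : κ → ℝ} {f : κ → 𝓢(E, ℂ)}
    (hf : SchwartzBoundedBy w f) (k l : ℕ) :
    ∃ C : ℝ, ∀ i x, (1 + ‖x‖) ^ k * ‖iteratedFDeriv ℝ l (f i) x‖ ≤ C * w i := by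
  choose D hD using hf
  refine ⟨2 ^ k * ∑ m ∈ Finset.Iic (k, l), D m.1 m.2, fun i x => ?_⟩
  refine (SchwartzMap.one_add_le_sup_seminorm_apply (𝕜 := ℂ) (m := (k, l)) le_rfl le_rfl
    (f i) x).trans ?_
  have h1 := Seminorm.finset_sup_le_sum (schwartzSeminormFamily ℂ E ℂ) (Finset.Iic (k, l)) (f i)
  rw [mul_assoc, Finset.sum_mul]
  refine mul_le_mul_of_nonneg_left (h1.trans ?_) (by positivity)
  rw [seminorm_sum_apply]
  exact Finset.sum_le_sum fun m _ => hD m.1 m.2 i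

theorem SchwartzBoundedBy.norm_le {w : κ → ℝ} {f : κ → 𝓢(E, ℂ)}
    (hf : SchwartzBoundedBy w f) (k : ℕ) :
    ∃ C : ℝ, ∀ i x, ‖f i x‖ ≤ C * w i * (1 + ‖x‖) ^ (-(k : ℝ)) := by
  obtain ⟨C, hC⟩ := hf.one_add_norm_pow_mul_le k 0
  refine ⟨C, fun i x => ?_⟩
  have h := hC i x
  rw [norm_iteratedFDeriv_zero] at h
  have hp : (0 : ℝ) < (1 + ‖x‖) ^ k := by positivity
  rw [Real.rpow_neg (by positivity), Real.rpow_natCast, ← div_eq_mul_inv, le_div_iff₀ hp]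
  linarith

theorem TemperateBoundedBy.hasTemperateGrowth {w : κ → ℝ} {a : κ → E → ℂ}
    (ha : TemperateBoundedBy w a) (i : κ) : (a i).HasTemperateGrowth := by
  refine ⟨ha.1 i, fun j => ?_⟩
  obtain ⟨N, C, h⟩ := ha.2 j
  exact ⟨N, C * w i, h i⟩

/-- Leibniz' rule: the polynomial growth of the derivatives of `a i` is absorbed by asking for more
decay of `f i`, namely the power `N j + k`. -/
theorem SchwartzBoundedBy.smulLeft {w v : κ → ℝ} {a : κ → E → ℂ} {f : κ → 𝓢(E, ℂ)}
    (hf : SchwartzBoundedBy v f) (ha : TemperateBoundedBy w a) :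
    SchwartzBoundedBy (fun i => w i * v i) (fun i => SchwartzMap.smulLeftCLM ℂ (a i) (f i)) := by
  intro k l
  choose N C hC using ha.2
  have hf' := fun j => hf.one_add_norm_pow_mul_le (N j + k) (l - j)
  choose D hD using hf'
  refine ⟨∑ j ∈ Finset.range (l + 1), (l.choose j : ℝ) * (C j * D j), fun i => ?_⟩
  have key : ∀ x, ‖x‖ ^ k * ‖iteratedFDeriv ℝ l (SchwartzMap.smulLeftCLM ℂ (a i) (f i)) x‖ ≤
      (∑ j ∈ Finset.range (l + 1), (l.choose j : ℝ) * (C j * D j)) * (w i * v i) := by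
    intro x
    rw [SchwartzMap.smulLeftCLM_apply (ha.hasTemperateGrowth i)]
    simp only [smul_eq_mul]
    have h1 := norm_iteratedFDeriv_mul_le (ha.1 i) ((f i).smooth ⊤) x
      (n := l) (by exact_mod_cast le_top)
    refine (mul_le_mul_of_nonneg_left h1 (by positivity)).trans ?_
    rw [Finset.mul_sum, Finset.sum_mul]
    refine Finset.sum_le_sum fun j _ => ?_
    have hxk : ‖x‖ ^ k ≤ (1 + ‖x‖) ^ k := pow_le_pow_left₀ (norm_nonneg x) (by linarith) k
    have hCw : 0 ≤ C j * w i := by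
      have := (norm_nonneg _).trans (hC j i x)
      have hp : (0 : ℝ) < (1 + ‖x‖) ^ N j := by positivity
      exact nonneg_of_mul_nonneg_left this hp
    calc ‖x‖ ^ k * ((l.choose j : ℝ) * ‖iteratedFDeriv ℝ j (a i) x‖ *
          ‖iteratedFDeriv ℝ (l - j) (f i) x‖)
        ≤ (1 + ‖x‖) ^ k * ((l.choose j : ℝ) * (C j * w i * (1 + ‖x‖) ^ N j) *
          ‖iteratedFDeriv ℝ (l - j) (f i) x‖) := by
          gcongr
          exact hC j i x
      _ = (l.choose j : ℝ) * (C j * w i) *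
          ((1 + ‖x‖) ^ (N j + k) * ‖iteratedFDeriv ℝ (l - j) (f i) x‖) := by ring
      _ ≤ (l.choose j : ℝ) * (C j * w i) * (D j * v i) := by
          refine mul_le_mul_of_nonneg_left (hD j i x) (by positivity)
      _ = _ := by ring
  refine SchwartzMap.seminorm_le_bound ℂ k l _ ?_ key
  exact (by positivity : (0 : ℝ) ≤ _).trans (key 0)

/-- Dominated convergence. Since `q ≥ 1`, one factor `‖f k x‖` supplies the integrable decay and the
remaining power `q - 1` is bounded uniformly. -/
theorem SchwartzBoundedBy.tendsto_integral_rpow_norm [FiniteDimensional ℝ E] [MeasurableSpace E]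
    [BorelSpace E] {μ : Measure E} [μ.HasTemperateGrowth] {f : ℕ → 𝓢(E, ℂ)}
    (hf : SchwartzBoundedBy (fun _ => 1) f) (h0 : ∀ x, Tendsto (fun k => f k x) atTop (𝓝 0))
    {q : ℝ} (hq : 1 ≤ q) :
    Tendsto (fun k => ∫ x, ‖f k x‖ ^ q ∂μ) atTop (𝓝 0) := by
  obtain ⟨C, hC⟩ := hf.norm_le μ.integrablePower
  obtain ⟨D, hD⟩ := hf.norm_le 0
  have hC0 : 0 ≤ C := by simpa using (norm_nonneg _).trans (hC 0 0)
  have hD0 : 0 ≤ D := by simpa using (norm_nonneg _).trans (hD 0 0)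
  have hq0 : 0 < q := by linarith
  have := tendsto_integral_of_dominated_convergence (μ := μ) (F := fun k x => ‖f k x‖ ^ q)
    (f := fun _ => 0) (fun x => D ^ (q - 1) * (C * (1 + ‖x‖) ^ (-(μ.integrablePower : ℝ))))
    (fun k => ((f k).continuous.norm.rpow_const fun _ => Or.inr hq0.le).aestronglyMeasurable)
    (((Measure.integrable_pow_neg_integrablePower μ).const_mul _).const_mul _)
    (fun k => ae_of_all _ fun x => ?_) (ae_of_all _ fun x => ?_)
  · simpa using this
  · have h1 := hC k x
    have h2 := hD k x
    simp only [mul_one, CharP.cast_eq_zero, neg_zero, Real.rpow_zero] at h1 h2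
    rw [Real.norm_of_nonneg (by positivity)]
    calc ‖f k x‖ ^ q = ‖f k x‖ ^ (q - 1) * ‖f k x‖ := by
          rcases (norm_nonneg (f k x)).eq_or_lt with h | h
          · rw [← h, Real.zero_rpow hq0.ne', mul_zero]
          · rw [Real.rpow_sub_one h.ne']; field_simp
      _ ≤ _ := by gcongr
  · have := ((h0 x).norm.rpow_const (p := q) (Or.inr hq0.le))
    simpa [Real.zero_rpow hq0.ne'] using this

end BoundedFamilies

/-! ### Smoothness and decay of families closed under differentiation -/

section Gradient

variable {n : ℕ}

/-- The linear form with coefficients `c i` with respect to the coordinates. -/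
def gradForm (c : Fin n → ℂ) : Euc n →L[ℝ] ℂ :=
  ∑ i, (EuclideanSpace.proj i : Euc n →L[ℝ] ℝ).smulRight (c i)

theorem gradForm_apply (c : Fin n → ℂ) (v : Euc n) : gradForm c v = ∑ i, (v i : ℂ) * c i := by
  simp [gradForm]

theorem norm_gradForm_le (c : Fin n → ℂ) : ‖gradForm c‖ ≤ ∑ i, ‖c i‖ := by
  refine ContinuousLinearMap.opNorm_le_bound _ (by positivity) fun v => ?_
  rw [gradForm_apply, Finset.sum_mul]
  refine (norm_sum_le _ _).trans (Finset.sum_le_sum fun i _ => ?_)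
  rw [norm_mul, mul_comm, Complex.norm_real]
  gcongr
  exact PiLp.norm_apply_le v i

theorem fderiv_eq_gradForm (F : Euc n →L[ℝ] ℂ) :
    F = gradForm fun i => F (EuclideanSpace.single i 1) := by
  ext v
  rw [gradForm_apply]
  have hv : v = ∑ i, v i • EuclideanSpace.single i (1 : ℝ) := by
    ext i
    simp [Finset.sum_apply, Pi.single_apply]
  conv_lhs => rw [hv, map_sum]
  simp

/-- The map `c ↦ c dx_i`. -/
def coordForm (i : Fin n) : ℂ →L[ℝ] (Euc n →L[ℝ] ℂ) :=
  ContinuousLinearMap.smulRightL ℝ (Euc n) ℂ (EuclideanSpace.proj i : Euc n →L[ℝ] ℝ)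

theorem gradForm_eq_sum_coordForm (c : Fin n → ℂ) : gradForm c = ∑ i, coordForm i (c i) := rfl

/-- If a class of families is closed under partial differentiation and its members decay rapidly,
then its members are uniformly bounded families of Schwartz functions. -/
theorem contDiff_and_decay_of_closed {κ : Type*} (P : (κ → Euc n → ℂ) → Prop)
    (hd : ∀ g, P g → ∃ g' : Fin n → κ → Euc n → ℂ, (∀ i, P (g' i)) ∧
      ∀ k x, HasFDerivAt (g k) (gradForm fun i => g' i k x) x)
    (hb : ∀ g, P g → ∀ M : ℕ, ∃ C : ℝ, ∀ k x, ‖x‖ ^ M * ‖g k x‖ ≤ C) (j : ℕ) :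
    ∀ g, P g → (∀ k, ContDiff ℝ j (g k)) ∧
      ∀ M : ℕ, ∃ C : ℝ, ∀ k x, ‖x‖ ^ M * ‖iteratedFDeriv ℝ j (g k) x‖ ≤ C := by
  induction j with
  | zero =>
    intro g hg
    refine ⟨fun k => ?_, fun M => ?_⟩
    · obtain ⟨g', -, h⟩ := hd g hg
      rw [Nat.cast_zero, contDiff_zero]
      exact continuous_iff_continuousAt.2 fun x => (h k x).continuousAt
    · simpa using hb g hg M
  | succ j ih =>
    intro g hg
    obtain ⟨g', hg', h⟩ := hd g hg
    have hf : ∀ k, fderiv ℝ (g k) = fun x => ∑ i, coordForm i (g' i k x) :=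
      fun k => funext fun x => (h k x).fderiv
    have hc : ∀ k i, ContDiff ℝ j (fun x => coordForm i (g' i k x)) := fun k i =>
      (coordForm i).contDiff.comp ((ih _ (hg' i)).1 k)
    refine ⟨fun k => ?_, fun M => ?_⟩
    · rw [Nat.cast_succ, contDiff_succ_iff_fderiv]
      refine ⟨fun x => (h k x).differentiableAt, by simp, ?_⟩
      rw [hf k]
      exact ContDiff.sum fun i _ => hc k i
    · choose C hC using fun i => (ih _ (hg' i)).2 M
      refine ⟨∑ i, ‖coordForm (n := n) i‖ * C i, fun k x => ?_⟩
      rw [← norm_iteratedFDeriv_fderiv, hf k,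
        iteratedFDeriv_fun_sum_apply fun i _ => (hc k i).contDiffAt]
      calc ‖x‖ ^ M * ‖∑ i, iteratedFDeriv ℝ j (fun x => coordForm i (g' i k x)) x‖
          ≤ ‖x‖ ^ M * ∑ i, ‖coordForm (n := n) i‖ * ‖iteratedFDeriv ℝ j (g' i k) x‖ := by
            gcongr
            refine norm_sum_le_of_le _ fun i _ => ?_
            exact (coordForm i).norm_iteratedFDeriv_comp_left
              ((ih _ (hg' i)).1 k).contDiffAt le_rfl
        _ = ∑ i, ‖coordForm (n := n) i‖ * (‖x‖ ^ M * ‖iteratedFDeriv ℝ j (g' i k) x‖) := by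
            rw [Finset.mul_sum]
            exact Finset.sum_congr rfl fun i _ => by ring
        _ ≤ _ := by
            gcongr with i
            exact hC i k x

end Gradient

/-! ### Oscillatory integrals -/

section Oscillatory

variable {n : ℕ} {κ : Type*}

/-- The jet of a smooth function `η ↦ Θ [] k η` with values in the Schwartz space: `Θ l k η` is its
derivative along the list `l` of coordinate directions; each derivative is bounded in the Schwartz
space, up to a polynomial factor in `η`. -/
structure IsAmplitude (Θ : List (Fin n) → κ → Euc n → 𝓢(Euc n, ℂ)) : Prop where
  bound : ∀ l, ∃ N : ℕ, SchwartzBoundedBy (fun q : κ × Euc n => (1 + ‖q.2‖) ^ N)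
    (fun q => Θ l q.1 q.2)
  deriv : ∀ l k y η, HasFDerivAt (fun η => Θ l k η y) (gradForm fun i => Θ (i :: l) k η y) η

/-- The character `e^{2πi y·η}`. -/
def character (y η : Euc n) : ℂ :=
  Complex.exp (((2 * Real.pi * inner ℝ y η : ℝ) : ℂ) * Complex.I)

theorem norm_character (y η : Euc n) : ‖character y η‖ = 1 := Complex.norm_exp_ofReal_mul_I _

theorem continuous_character (η : Euc n) : Continuous fun y => character y η := by
  unfold character
  fun_prop

/-- Multiplication by the `i`-th coordinate. -/
def coordMul (i : Fin n) : 𝓢(Euc n, ℂ) →L[ℂ] 𝓢(Euc n, ℂ) :=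
  SchwartzMap.smulLeftCLM ℂ fun y => ((y i : ℝ) : ℂ)

theorem coordMul_apply (i : Fin n) (f : 𝓢(Euc n, ℂ)) (y : Euc n) :
    coordMul i f y = (y i : ℂ) * f y := by
  have h : Function.HasTemperateGrowth fun y : Euc n => ((y i : ℝ) : ℂ) :=
    (Complex.ofRealCLM ∘L (EuclideanSpace.proj i : Euc n →L[ℝ] ℝ)).hasTemperateGrowth
  simp [coordMul, SchwartzMap.smulLeftCLM_apply_apply h]

/-- The oscillatory integral `∫ e^{2πi y·η} Θ(η)(y) dy`. -/
def oscInt (Θ : List (Fin n) → κ → Euc n → 𝓢(Euc n, ℂ)) (k : κ) (η : Euc n) : ℂ :=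
  ∫ y, character y η * Θ [] k η y

/-- The amplitude of the derivative of an oscillatory integral. -/
def amplitudeDeriv (i : Fin n) (Θ : List (Fin n) → κ → Euc n → 𝓢(Euc n, ℂ)) :
    List (Fin n) → κ → Euc n → 𝓢(Euc n, ℂ) :=
  fun l k η => Θ (l ++ [i]) k η + (2 * Real.pi * Complex.I : ℂ) • coordMul i (Θ l k η)

theorem oscInt_eq_fourierInv (Θ : List (Fin n) → κ → Euc n → 𝓢(Euc n, ℂ)) (k : κ) (η : Euc n) :
    oscInt Θ k η = 𝓕⁻ (Θ [] k η) η := by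
  rw [SchwartzMap.fourierInv_coe, Real.fourierInv_eq']
  rfl

theorem gradForm_add (c d : Fin n → ℂ) : gradForm (fun i => c i + d i) = gradForm c + gradForm d := by
  ext v
  simp [gradForm_apply, mul_add, Finset.sum_add_distrib]

theorem gradForm_const_mul (a : ℂ) (c : Fin n → ℂ) :
    gradForm (fun i => a * c i) = a • gradForm c := by
  ext v
  simp only [gradForm_apply, Finset.mul_sum, smul_apply, smul_eq_mul]
  exact Finset.sum_congr rfl fun i _ => by ring

/-- Differentiating the character produces the factor `2πi y_i`. The new direction `i` is appended
at the end of the list while `deriv` adds directions at its head, so the two operations do not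
interfere and no exchange of partial derivatives is needed. -/
theorem IsAmplitude.amplitudeDeriv {Θ : List (Fin n) → κ → Euc n → 𝓢(Euc n, ℂ)}
    (hΘ : IsAmplitude Θ) (i : Fin n) : IsAmplitude (amplitudeDeriv i Θ) where
  bound l := by
    obtain ⟨N, hN⟩ := hΘ.bound (l ++ [i])
    obtain ⟨N', hN'⟩ := hΘ.bound l
    refine ⟨max N N', SchwartzBoundedBy.add (hN.mono (fun q => by positivity) fun q => ?_)
      ((hN'.map ((2 * Real.pi * Complex.I : ℂ) • coordMul i)).mono
        (fun q => by positivity) fun q => ?_)⟩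
    · exact pow_le_pow_right₀ (by simp) (le_max_left _ _)
    · exact pow_le_pow_right₀ (by simp) (le_max_right _ _)
  deriv l k y η := by
    have h1 := hΘ.deriv (l ++ [i]) k y η
    have h2 := (hΘ.deriv l k y η).const_mul (2 * Real.pi * Complex.I * (y i : ℂ))
    rw [← gradForm_const_mul] at h2
    have h3 := h1.add h2
    rw [← gradForm_add] at h3
    refine (h3.congr_fderiv ?_).congr_of_eventuallyEq (Eventually.of_forall fun η' => ?_)
    · congr 1
      funext j
      simp [MPseudo.amplitudeDeriv, coordMul_apply, mul_assoc]
    · simp [MPseudo.amplitudeDeriv, coordMul_apply, mul_assoc]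

theorem hasFDerivAt_character (y η : Euc n) :
    HasFDerivAt (fun η => character y η)
      (gradForm fun i => character y η * (2 * Real.pi * Complex.I * (y i : ℂ))) η := by
  have h1 : HasFDerivAt (fun η : Euc n => ((2 * Real.pi * inner ℝ y η : ℝ) : ℂ) * Complex.I)
      (gradForm fun i => 2 * Real.pi * Complex.I * (y i : ℂ)) η := by
    have h : (fun η : Euc n => ((2 * Real.pi * inner ℝ y η : ℝ) : ℂ) * Complex.I) =
        gradForm fun i => 2 * Real.pi * Complex.I * (y i : ℂ) := by
      funext v
      rw [gradForm_apply, PiLp.inner_apply]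
      push_cast
      rw [Finset.mul_sum, Finset.sum_mul]
      refine Finset.sum_congr rfl fun i _ => ?_
      simp
      ring
    rw [h]
    exact ContinuousLinearMap.hasFDerivAt _
  have h2 := h1.cexp
  rw [gradForm_const_mul]
  exact h2

/-- Differentiation under the integral sign; the integrable majorant has to be uniform only for `η'`
in the unit ball around `η`, where the polynomial weight is at most `(1 + (‖η‖ + 1)) ^ N i`. -/
theorem IsAmplitude.hasFDerivAt_oscInt {Θ : List (Fin n) → κ → Euc n → 𝓢(Euc n, ℂ)}
    (hΘ : IsAmplitude Θ) (k : κ) (η : Euc n) :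
    HasFDerivAt (oscInt Θ k) (gradForm fun i => oscInt (MPseudo.amplitudeDeriv i Θ) k η) η := by
  set M := (volume : Measure (Euc n)).integrablePower
  have hA := fun i => hΘ.amplitudeDeriv i
  choose N hN using fun i => (hA i).bound []
  choose C hC using fun i => (hN i).norm_le M
  have hint : ∀ (f : 𝓢(Euc n, ℂ)) (η : Euc n), Integrable (fun y => character y η * f y) :=
    fun f η => f.integrable.bdd_mul (continuous_character η).aestronglyMeasurable
      (ae_of_all _ fun y => (norm_character y η).le)
  have hgrad : ∀ η, (gradForm fun i => oscInt (MPseudo.amplitudeDeriv i Θ) k η) =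
      ∫ y, gradForm fun i => character y η * MPseudo.amplitudeDeriv i Θ [] k η y := by
    intro η
    simp only [gradForm_eq_sum_coordForm]
    rw [integral_finsetSum _ fun i _ =>
      (coordForm i).integrable_comp (hint _ _)]
    refine Finset.sum_congr rfl fun i _ => ?_
    rw [(coordForm i).integral_comp_comm (hint _ _)]
    rfl
  rw [hgrad]
  refine hasFDerivAt_integral_of_dominated_of_fderiv_le (𝕜 := ℝ)
    (F := fun η y => character y η * Θ [] k η y)
    (F' := fun η y => gradForm fun i => character y η * MPseudo.amplitudeDeriv i Θ [] k η y)
    (Metric.ball_mem_nhds η one_pos)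
    (bound := fun y => ∑ i, C i * (1 + (‖η‖ + 1)) ^ N i * (1 + ‖y‖) ^ (-(M : ℝ)))
    (Eventually.of_forall fun η' => (hint _ _).aestronglyMeasurable) (hint _ _) ?_ ?_ ?_ ?_
  · simp only [gradForm_eq_sum_coordForm]
    exact (integrable_finsetSum _ fun i _ =>
      (coordForm i).integrable_comp (hint _ _)).aestronglyMeasurable
  · refine ae_of_all _ fun y η' hη' => (norm_gradForm_le _).trans (Finset.sum_le_sum fun i _ => ?_)
    rw [norm_mul, norm_character, one_mul]
    refine (hC i (k, η') y).trans ?_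
    have h0 : 0 ≤ C i := by
      have := (norm_nonneg _).trans (hC i (k, 0) 0)
      simpa using this
    have h1 : ‖η'‖ ≤ ‖η‖ + 1 := by
      have := norm_le_norm_add_norm_sub' η' η
      rw [mem_ball_iff_norm] at hη'
      linarith
    gcongr
  · exact integrable_finsetSum _ fun i _ =>
      (Measure.integrable_pow_neg_integrablePower volume).const_mul _
  · refine ae_of_all _ fun y η' _ => ?_
    have h := (hasFDerivAt_character y η').mul (hΘ.deriv [] k y η')
    refine h.congr_fderiv ?_
    rw [← gradForm_const_mul, ← gradForm_const_mul, ← gradForm_add]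
    congr 1
    funext i
    simp [MPseudo.amplitudeDeriv, coordMul_apply]
    ring

/-- The variable `η` occurs twice, as a parameter of the amplitude and as a frequency. Treating `(k,
η)` as the index of a family, the inverse Fourier transforms decay to order `M + N` in the frequency
with a loss of `(1 + ‖η‖)^N` from the parameter. On the diagonal this leaves decay of order `M`. -/
theorem IsAmplitude.decay_oscInt {Θ : List (Fin n) → κ → Euc n → 𝓢(Euc n, ℂ)}
    (hΘ : IsAmplitude Θ) (M : ℕ) : ∃ C : ℝ, ∀ k η, ‖η‖ ^ M * ‖oscInt Θ k η‖ ≤ C := by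
  obtain ⟨N, hN⟩ := hΘ.bound []
  obtain ⟨C, hC⟩ := (hN.map (FourierTransform.fourierInvCLM ℂ 𝓢(Euc n, ℂ))).one_add_norm_pow_mul_le
    (M + N) 0
  refine ⟨C, fun k η => ?_⟩
  have h := hC (k, η) η
  rw [norm_iteratedFDeriv_zero] at h
  rw [oscInt_eq_fourierInv]
  change _ * ‖𝓕⁻ (Θ [] k η) η‖ ≤ _ at h
  have hp : (0 : ℝ) < (1 + ‖η‖) ^ N := by positivity
  refine le_of_mul_le_mul_right ?_ hp
  refine le_trans ?_ h
  rw [pow_add, mul_right_comm]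
  gcongr
  linarith

/-- The oscillatory integrals of an amplitude form a bounded family of Schwartz functions. -/
theorem IsAmplitude.exists_schwartz {Θ : List (Fin n) → κ → Euc n → 𝓢(Euc n, ℂ)}
    (hΘ : IsAmplitude Θ) : ∃ G : κ → 𝓢(Euc n, ℂ), (∀ k η, G k η = oscInt Θ k η) ∧
      SchwartzBoundedBy (fun _ => 1) G := by
  -- The class of families is that of all oscillatory integrals of amplitudes; it is closed under
  -- differentiation because `amplitudeDeriv` is again an amplitude.
  have key := fun j => contDiff_and_decay_of_closed (κ := κ)
    (fun g => ∃ Θ : List (Fin n) → κ → Euc n → 𝓢(Euc n, ℂ), IsAmplitude Θ ∧ g = oscInt Θ)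
    (by
      rintro _ ⟨Θ, hΘ, rfl⟩
      exact ⟨fun i => oscInt (MPseudo.amplitudeDeriv i Θ),
        fun i => ⟨_, hΘ.amplitudeDeriv i, rfl⟩, hΘ.hasFDerivAt_oscInt⟩)
    (by
      rintro _ ⟨Θ, hΘ, rfl⟩ M
      exact hΘ.decay_oscInt M) j (oscInt Θ) ⟨Θ, hΘ, rfl⟩
  choose C hC using fun j => (key j).2
  refine ⟨fun k => ⟨oscInt Θ k, contDiff_infty.2 fun j => (key j).1 k,
    fun M j => ⟨C j M, hC j M k⟩⟩, fun k η => rfl, fun M j => ⟨|C j M|, fun k => ?_⟩⟩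
  rw [mul_one]
  exact SchwartzMap.seminorm_le_bound ℂ M j _ (abs_nonneg _)
    fun x => (hC j M k x).trans (le_abs_self _)

end Oscillatory

/-! ### Estimates for powers of a weight function -/

section Weight

variable {n : ℕ}

theorem iteratedFDeriv_comp_affine_norm_le {E F : Type*} [NormedAddCommGroup E] [NormedSpace ℝ E]
    [NormedAddCommGroup F] [NormedSpace ℝ F] {f : E → F} (hf : ContDiff ℝ ∞ f) (a : E) (c : ℝ)
    (j : ℕ) (x : E) : ‖iteratedFDeriv ℝ j (fun x => f (a + c • x)) x‖ ≤
      |c| ^ j * ‖iteratedFDeriv ℝ j f (a + c • x)‖ := by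
  have hg : ContDiff ℝ ∞ (fun x => f (a + x)) := hf.comp (contDiff_const.add contDiff_id)
  have h := (c • ContinuousLinearMap.id ℝ E).iteratedFDeriv_comp_right hg x
    (i := j) (by exact_mod_cast le_top)
  have h2 : (fun x => f (a + c • x)) = (fun x => f (a + x)) ∘ (c • ContinuousLinearMap.id ℝ E) := by
    funext x
    simp
  rw [h2, h]
  refine (ContinuousMultilinearMap.norm_compContinuousLinearMap_le _ _).trans ?_
  rw [iteratedFDeriv_comp_add_left, mul_comm, Finset.prod_const, Finset.card_univ, Fintype.card_fin]
  have h3 : ‖c • ContinuousLinearMap.id ℝ E‖ ≤ |c| := by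
    rw [norm_smul, Real.norm_eq_abs]
    exact mul_le_of_le_one_right (abs_nonneg _) ContinuousLinearMap.norm_id_le
  simp only [smul_apply, ContinuousLinearMap.id_apply]
  gcongr

variable (Λ : WeightFunction n) {ρ : ℝ}

/-- The weight is bounded below by a positive constant, possibly less than `1`; this is the source
of the factor `c ^ (t - r)`. -/
theorem WeightFunction.rpow_le_rpow {t r : ℝ} (h : t ≤ r) :
    ∃ C : ℝ, 0 < C ∧ ∀ ξ, Λ ξ ^ t ≤ C * Λ ξ ^ r := by
  obtain ⟨c, hc, hlow⟩ := Λ.exists_lower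
  refine ⟨c ^ (t - r), by positivity, fun ξ => ?_⟩
  have h1 := rpow_le_of_lower hc (hlow ξ) (t - r) (by linarith)
  have h2 : Λ ξ ^ t = Λ ξ ^ (t - r) * Λ ξ ^ r := by
    rw [← Real.rpow_add (Λ.pos ξ)]
    congr 1
    ring
  rw [h2]
  exact mul_le_mul_of_nonneg_right h1 (Real.rpow_nonneg (Λ.pos ξ).le _)

theorem multiLength_count (l : List (Fin n)) : multiLength (fun i => l.count i) = l.length := by
  rw [multiLength, ← List.sum_toFinset_count_eq_length l]
  refine (Finset.sum_subset (Finset.subset_univ _) fun i _ hi => ?_).symm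
  exact List.count_eq_zero.2 fun h => hi (List.mem_toFinset.2 h)

theorem WeightFunction.norm_iteratedFDeriv_le (hρ : ρ ≤ 1 / Λ.μ) (j : ℕ) :
    ∃ C : ℝ, 0 < C ∧ ∀ ξ, ‖iteratedFDeriv ℝ j Λ.toFun ξ‖ ≤ C * Λ ξ ^ (1 - ρ * j) := by
  have hb : ∀ l : List (Fin n), ∃ C : ℝ, 0 < C ∧ ∀ ξ,
      ‖listDeriv l Λ.toFun ξ‖ ≤ C * Λ ξ ^ (1 - ρ * l.length) := by
    intro l
    obtain ⟨C, hC, h⟩ := Λ.deriv_bound (fun i => l.count i) 0 (by simp)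
    have hle : 1 - 1 / Λ.μ * (l.length : ℝ) ≤ 1 - ρ * l.length := by
      have : ρ * (l.length : ℝ) ≤ 1 / Λ.μ * l.length := by gcongr
      linarith
    obtain ⟨D, hD, h'⟩ := Λ.rpow_le_rpow hle
    refine ⟨C * D, by positivity, fun ξ => ?_⟩
    have := h ξ
    rw [multiLength_count, add_zero, ← listDeriv_eq_multiDeriv Λ.smooth] at this
    simp only [monomial, Pi.zero_apply, pow_zero, Finset.prod_const_one, one_mul] at this
    rw [Real.norm_eq_abs, mul_assoc]
    exact this.trans (mul_le_mul_of_nonneg_left (h' ξ) hC.le)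
  choose C hC h using hb
  -- The summand `1` keeps the constant positive when the sum is empty.
  refine ⟨1 + ∑ J : Fin j → Fin n, C (List.ofFn J), ?_, fun ξ => ?_⟩
  · have : 0 ≤ ∑ J : Fin j → Fin n, C (List.ofFn J) := Finset.sum_nonneg fun J _ => (hC _).le
    linarith
  · refine (norm_multilinear_le _).trans ?_
    have h0 : 0 ≤ Λ ξ ^ (1 - ρ * j) := Real.rpow_nonneg (Λ.pos ξ).le _
    rw [add_mul, one_mul, Finset.sum_mul]
    refine le_add_of_nonneg_of_le h0 (Finset.sum_le_sum fun J _ => ?_)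
    rw [iteratedFDeriv_apply_single Λ.smooth]
    simpa using h (List.ofFn J) ξ

theorem WeightFunction.contDiff_rpow (t : ℝ) : ContDiff ℝ ∞ fun ξ => Λ ξ ^ t :=
  Λ.smooth.rpow_const_of_ne fun ξ => (Λ.pos ξ).ne'

/-- Strong induction through `∇(Λ^t) = t Λ^{t-1} ∇Λ` and Leibniz' rule: the exponents `t - 1 - ρ i`
and `1 - ρ (j - i + 1)` add up to `t - ρ (j + 1)`. -/
theorem WeightFunction.norm_iteratedFDeriv_rpow_le (hρ : ρ ≤ 1 / Λ.μ) (j : ℕ) :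
    ∀ t : ℝ, ∃ C : ℝ, 0 < C ∧ ∀ ξ,
      ‖iteratedFDeriv ℝ j (fun ξ => Λ ξ ^ t) ξ‖ ≤ C * Λ ξ ^ (t - ρ * j) := by
  induction j using Nat.strong_induction_on with
  | _ j ih =>
  intro t
  rcases j with _ | j
  · refine ⟨1, one_pos, fun ξ => ?_⟩
    rw [norm_iteratedFDeriv_zero, Real.norm_of_nonneg (Real.rpow_nonneg (Λ.pos ξ).le _)]
    simp
  · choose! C hC h using fun i (hi : i < j + 1) => ih i hi (t - 1)
    choose D hD h' using Λ.norm_iteratedFDeriv_le hρ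
    have hf : fderiv ℝ (fun ξ => Λ ξ ^ t) = fun ξ => Λ ξ ^ (t - 1) • (t • fderiv ℝ Λ.toFun ξ) := by
      funext ξ
      have h1 := (Λ.smooth.differentiable (by simp) ξ).hasFDerivAt.rpow_const
        (p := t) (Or.inl (Λ.pos ξ).ne')
      rw [h1.fderiv, smul_smul, mul_comm]
    refine ⟨1 + ∑ i ∈ Finset.range (j + 1), (j.choose i : ℝ) * C i * (|t| * D (j - i + 1)), ?_,
      fun ξ => ?_⟩
    · have : 0 ≤ ∑ i ∈ Finset.range (j + 1), (j.choose i : ℝ) * C i * (|t| * D (j - i + 1)) :=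
        Finset.sum_nonneg fun i hi => by
          have := hC i (Finset.mem_range.1 hi)
          have := hD (j - i + 1)
          positivity
      linarith
    · have hd : ContDiff ℝ ∞ (fderiv ℝ Λ.toFun) := Λ.smooth.fderiv_right (by simp)
      rw [← norm_iteratedFDeriv_fderiv, hf]
      refine (norm_iteratedFDeriv_smul_le (Λ.contDiff_rpow (t - 1))
        (hd.const_smul t) ξ (by exact_mod_cast le_top)).trans ?_
      rw [add_mul, one_mul, Finset.sum_mul]
      refine le_add_of_nonneg_of_le (Real.rpow_nonneg (Λ.pos ξ).le _)
        (Finset.sum_le_sum fun i hi => ?_)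
      have hi' := Finset.mem_range.1 hi
      rw [iteratedFDeriv_const_smul_apply' (contDiff_infty.1 hd _).contDiffAt, norm_smul,
        norm_iteratedFDeriv_fderiv, Real.norm_eq_abs]
      have h1 := h i hi' ξ
      have h2 := h' (j - i + 1) ξ
      have h3 : Λ ξ ^ (t - ρ * ((j + 1 : ℕ) : ℝ)) =
          Λ ξ ^ (t - 1 - ρ * i) * Λ ξ ^ (1 - ρ * ((j - i + 1 : ℕ) : ℝ)) := by
        rw [← Real.rpow_add (Λ.pos ξ)]
        congr 1
        rw [Nat.cast_add, Nat.cast_add, Nat.cast_sub (by omega)]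
        push_cast
        ring
      rw [h3]
      have hC' := hC i hi'
      have hp := Λ.pos ξ
      calc _ ≤ (j.choose i : ℝ) * (C i * Λ ξ ^ (t - 1 - ρ * i)) *
            (|t| * (D (j - i + 1) * Λ ξ ^ (1 - ρ * ((j - i + 1 : ℕ) : ℝ)))) := by gcongr
        _ = _ := by ring

/-- The exponent `ρ` is the one for which the gradient bound `Λ^{t-ρ}` on `Λ^t` becomes constant. -/
theorem WeightFunction.rpow_lipschitz (hρ : ρ ≤ 1 / Λ.μ) :
    ∃ L : ℝ, 0 < L ∧ ∀ ξ η, |Λ ξ ^ ρ - Λ η ^ ρ| ≤ L * ‖ξ - η‖ := by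
  obtain ⟨L, hL, h⟩ := Λ.norm_iteratedFDeriv_rpow_le hρ 1 ρ
  refine ⟨L, hL, fun ξ η => ?_⟩
  refine convex_univ.norm_image_sub_le_of_norm_fderiv_le (𝕜 := ℝ) (f := fun ξ => Λ ξ ^ ρ)
    (fun x _ => (Λ.contDiff_rpow ρ).differentiable (by simp) x) (fun x _ => ?_)
    (Set.mem_univ _) (Set.mem_univ _)
  simpa [norm_iteratedFDeriv_one] using h x

/-- The frequency scale `Λ(ξ₀)^{ρ/2}` of a wave packet at `ξ₀`. -/
def WeightFunction.scale (ρ : ℝ) (ξ₀ : Euc n) : ℝ := Λ ξ₀ ^ (ρ / 2)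

theorem WeightFunction.scale_pos (ρ : ℝ) (ξ₀ : Euc n) : 0 < Λ.scale ρ ξ₀ :=
  Real.rpow_pos_of_pos (Λ.pos _) _

theorem WeightFunction.one_le_scale (hρ0 : 0 < ρ) {ξ₀ : Euc n} (h : 1 ≤ Λ ξ₀) :
    1 ≤ Λ.scale ρ ξ₀ := Real.one_le_rpow h (by positivity)

theorem WeightFunction.scale_mul_self (ρ : ℝ) (ξ₀ : Euc n) :
    Λ.scale ρ ξ₀ * Λ.scale ρ ξ₀ = Λ ξ₀ ^ ρ := by
  rw [scale, ← Real.rpow_add (Λ.pos _)]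
  congr 1
  ring

/-- A Peetre-type inequality: over a displacement of `η` packet widths the weight changes at most by
a factor polynomial in `η`, uniformly in `ξ₀`. It comes from the Lipschitz bound for `Λ^ρ`, since
the displacement has length comparable to `w ‖η‖` with `w² = Λ(ξ₀)^ρ`. -/
theorem WeightFunction.ratio_rpow_le (hρ0 : 0 < ρ) (hρ : ρ ≤ 1 / Λ.μ) (r : ℝ) :
    ∃ (N : ℕ) (C : ℝ), 0 < C ∧ ∀ ξ₀ η : Euc n, 1 ≤ Λ ξ₀ →
      (Λ (ξ₀ + (2 * Real.pi * Λ.scale ρ ξ₀) • η) / Λ ξ₀) ^ r ≤ C * (1 + ‖η‖) ^ N := by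
  obtain ⟨L₀, hL₀, hlip⟩ := Λ.rpow_lipschitz hρ
  obtain ⟨c, hc, hlow⟩ := Λ.exists_lower
  set L := L₀ * (2 * Real.pi) with hL
  have hLpos : 0 < L := by positivity
  have hcρ : 0 < c ^ ρ := by positivity
  -- `K` is large enough to serve both the upper bound `up` and the lower bound `down`.
  set K := 2 + L + L ^ 2 / c ^ ρ with hK
  have hK0 : 0 < K := by positivity
  refine ⟨⌈2 * (|r| / ρ)⌉₊, K ^ (|r| / ρ), by positivity, fun ξ₀ η h1 => ?_⟩
  set a := Λ ξ₀ with ha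
  set w := Λ.scale ρ ξ₀ with hw
  set b := Λ (ξ₀ + (2 * Real.pi * w) • η) with hb
  have ha0 : 0 < a := Λ.pos _
  have hb0 : 0 < b := Λ.pos _
  have hw1 : 1 ≤ w := Λ.one_le_scale hρ0 h1
  have hww : w * w = a ^ ρ := Λ.scale_mul_self ρ ξ₀
  have hlip' : |b ^ ρ - a ^ ρ| ≤ L * w * ‖η‖ := by
    refine (hlip _ _).trans (le_of_eq ?_)
    rw [add_sub_cancel_left, norm_smul, Real.norm_of_nonneg (by positivity)]
    ring
  have hbc : c ^ ρ ≤ b ^ ρ := Real.rpow_le_rpow hc.le (hlow _) hρ0.le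
  obtain ⟨h2, h3⟩ := abs_le.1 hlip'
  have hx := norm_nonneg η
  set x := ‖η‖ with hxdef
  have hbρ : 0 < b ^ ρ := by positivity
  have haρ : 0 < a ^ ρ := by positivity
  have up : (b / a) ^ ρ ≤ K * (1 + x) ^ (2 : ℝ) := by
    rw [Real.div_rpow hb0.le ha0.le, div_le_iff₀ haρ, Real.rpow_two]
    have e1 : L * w * x ≤ L * x * a ^ ρ := by
      rw [← hww]
      have : w ≤ w * w := by nlinarith
      have : 0 ≤ L * x := by positivity
      nlinarith
    have e2 : 1 + L * x ≤ K * (1 + x) ^ 2 := by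
      have : 0 ≤ L ^ 2 / c ^ ρ := by positivity
      have e3 : (2 + L) * (1 + x) ^ 2 ≤ K * (1 + x) ^ 2 := by gcongr; linarith
      nlinarith [mul_nonneg hLpos.le hx, mul_nonneg hLpos.le (sq_nonneg x)]
    calc b ^ ρ ≤ (1 + L * x) * a ^ ρ := by linarith
      _ ≤ _ := by gcongr
  have down : (b / a) ^ (-ρ) ≤ K * (1 + x) ^ (2 : ℝ) := by
    rw [Real.rpow_neg (by positivity), ← Real.inv_rpow (by positivity), inv_div,
      Real.div_rpow ha0.le hb0.le, div_le_iff₀ hbρ, Real.rpow_two]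
    -- By the inequality between arithmetic and geometric means, half of `a ^ ρ` can be moved to the
    -- left-hand side; the remaining `L² x²` is absorbed by `b ^ ρ ≥ c ^ ρ`.
    have e1 : L * w * x ≤ a ^ ρ / 2 + L ^ 2 * x ^ 2 / 2 := by
      rw [← hww]
      nlinarith [sq_nonneg (w - L * x)]
    have e2 : a ^ ρ ≤ 2 * b ^ ρ + L ^ 2 * x ^ 2 := by linarith
    have e3 : L ^ 2 * x ^ 2 ≤ L ^ 2 / c ^ ρ * x ^ 2 * b ^ ρ := by
      rw [div_mul_eq_mul_div, div_mul_eq_mul_div, le_div_iff₀ hcρ]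
      gcongr
    have e4 : 2 + L ^ 2 / c ^ ρ * x ^ 2 ≤ K * (1 + x) ^ 2 := by
      have h0 : 0 ≤ L ^ 2 / c ^ ρ := by positivity
      have : K * (1 + x) ^ 2 = (2 + L ^ 2 / c ^ ρ * x ^ 2) + (L * (1 + x) ^ 2 + 4 * x + 2 * x ^ 2
        + L ^ 2 / c ^ ρ * (1 + 2 * x)) := by rw [hK]; ring
      rw [this]
      have : 0 ≤ L * (1 + x) ^ 2 + 4 * x + 2 * x ^ 2 + L ^ 2 / c ^ ρ * (1 + 2 * x) := by positivity
      linarith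
    calc a ^ ρ ≤ (2 + L ^ 2 / c ^ ρ * x ^ 2) * b ^ ρ := by linarith
      _ ≤ _ := by gcongr
  have hba : 0 < b / a := by positivity
  have main : (b / a) ^ r ≤ (K * (1 + x) ^ (2 : ℝ)) ^ (|r| / ρ) := by
    rcases le_total 0 r with hr | hr
    · rw [abs_of_nonneg hr]
      calc (b / a) ^ r = ((b / a) ^ ρ) ^ (r / ρ) := by
            rw [← Real.rpow_mul hba.le]; congr 1; field_simp
        _ ≤ _ := Real.rpow_le_rpow (by positivity) up (by positivity)
    · rw [abs_of_nonpos hr]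
      calc (b / a) ^ r = ((b / a) ^ (-ρ)) ^ (-r / ρ) := by
            rw [← Real.rpow_mul hba.le]; congr 1; field_simp
        _ ≤ _ := Real.rpow_le_rpow (by positivity) down (div_nonneg (by linarith) hρ0.le)
  refine main.trans ?_
  rw [Real.mul_rpow hK0.le (by positivity), ← Real.rpow_mul (by positivity)]
  refine mul_le_mul_of_nonneg_left ?_ (by positivity)
  rw [← Real.rpow_natCast]
  exact Real.rpow_le_rpow_of_exponent_le (by linarith) (Nat.le_ceil _)

/-- Each frequency derivative in packet coordinates costs one factor `Λ(ξ₀)^{ρ/2}`, which is at most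
the factor `Λ(ξ₀)^ρ` needed to balance the gain `Λ(ξ)^{-ρ}`. -/
theorem WeightFunction.scale_pow_mul_le (hρ0 : 0 < ρ) {ξ₀ : Euc n} (h : 1 ≤ Λ ξ₀) (j : ℕ) (t : ℝ)
    (ξ : Euc n) : Λ.scale ρ ξ₀ ^ j * Λ ξ ^ (t - ρ * j) * Λ ξ₀ ^ (-t) ≤
      (Λ ξ / Λ ξ₀) ^ (t - ρ * j) := by
  have h1 := Λ.one_le_scale hρ0 h
  have h0 := Λ.pos ξ₀
  have hξ := Λ.pos ξ
  have h2 : Λ.scale ρ ξ₀ ^ j ≤ Λ ξ₀ ^ (ρ * j) := by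
    rw [Real.rpow_mul h0.le, Real.rpow_natCast, ← Λ.scale_mul_self]
    gcongr
    nlinarith
  have h3 : Λ ξ₀ ^ (ρ * j) = Λ ξ₀ ^ (-(t - ρ * j)) * Λ ξ₀ ^ t := by
    rw [← Real.rpow_add h0]; congr 1; ring
  calc Λ.scale ρ ξ₀ ^ j * Λ ξ ^ (t - ρ * j) * Λ ξ₀ ^ (-t)
      ≤ Λ ξ₀ ^ (ρ * j) * Λ ξ ^ (t - ρ * j) * Λ ξ₀ ^ (-t) := by gcongr
    _ = _ := by
      rw [h3, Real.div_rpow hξ.le h0.le, Real.rpow_neg h0.le, Real.rpow_neg h0.le]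
      field_simp

/-- The normalized power `(Λ(ξ₀ + 2πλη) / Λ(ξ₀))^t`, where `λ = Λ(ξ₀)^{ρ/2}`. -/
def WeightFunction.packetPow (ρ t : ℝ) (ξ₀ η : Euc n) : ℂ :=
  (((Λ (ξ₀ + (2 * Real.pi * Λ.scale ρ ξ₀) • η) / Λ ξ₀) ^ t : ℝ) : ℂ)

/-- Seen by a packet, a power of the weight divided by its value at the centre is a multiplier with
bounds independent of the centre. -/
theorem WeightFunction.packetPow_temperate (hρ0 : 0 < ρ) (hρ : ρ ≤ 1 / Λ.μ) (t : ℝ) {κ : Type*}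
    {ξ₀ : κ → Euc n} (h : ∀ k, 1 ≤ Λ (ξ₀ k)) :
    TemperateBoundedBy (fun _ => 1) fun k => Λ.packetPow ρ t (ξ₀ k) := by
  have hfun : ∀ k, Λ.packetPow ρ t (ξ₀ k) = fun η => Complex.ofRealCLM
      (Λ (ξ₀ k) ^ (-t) • Λ (ξ₀ k + (2 * Real.pi * Λ.scale ρ (ξ₀ k)) • η) ^ t) := by
    intro k
    funext η
    have h0 := Λ.pos (ξ₀ k)
    rw [packetPow, Real.div_rpow (Λ.pos _).le h0.le, Real.rpow_neg h0.le, Complex.ofRealCLM_apply,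
      smul_eq_mul, div_eq_inv_mul]
  have hc : ∀ k, ContDiff ℝ ∞ fun η =>
      Λ (ξ₀ k + (2 * Real.pi * Λ.scale ρ (ξ₀ k)) • η) ^ t := fun k =>
    (Λ.contDiff_rpow t).comp (contDiff_const.add (contDiff_id.const_smul _))
  refine ⟨fun k => ?_, fun j => ?_⟩
  · beta_reduce
    rw [hfun k]
    exact Complex.ofRealCLM.contDiff.comp ((hc k).const_smul _)
  · obtain ⟨C, hC, hb⟩ := Λ.norm_iteratedFDeriv_rpow_le hρ j t
    obtain ⟨N, D, hD, hr⟩ := Λ.ratio_rpow_le hρ0 hρ (t - ρ * j)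
    refine ⟨N, C * (2 * Real.pi) ^ j * D, fun k η => ?_⟩
    beta_reduce
    rw [hfun k, mul_one]
    have hs := Λ.scale_pos ρ (ξ₀ k)
    have h0 := Λ.pos (ξ₀ k)
    refine (Complex.ofRealCLM.norm_iteratedFDeriv_comp_left
      ((hc k).const_smul _).contDiffAt (by exact_mod_cast le_top)).trans ?_
    rw [Complex.ofRealCLM_norm, one_mul,
      iteratedFDeriv_const_smul_apply' (contDiff_infty.1 (hc k) _).contDiffAt, norm_smul,
      Real.norm_of_nonneg (by positivity)]
    have h1 := iteratedFDeriv_comp_affine_norm_le (Λ.contDiff_rpow t) (ξ₀ k)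
      (2 * Real.pi * Λ.scale ρ (ξ₀ k)) j η
    rw [abs_of_pos (by positivity)] at h1
    have h2 := hb (ξ₀ k + (2 * Real.pi * Λ.scale ρ (ξ₀ k)) • η)
    have h3 := Λ.scale_pow_mul_le hρ0 (h k) j t (ξ₀ k + (2 * Real.pi * Λ.scale ρ (ξ₀ k)) • η)
    have h4 := hr (ξ₀ k) η (h k)
    set ξ := ξ₀ k + (2 * Real.pi * Λ.scale ρ (ξ₀ k)) • η
    calc _ ≤ Λ (ξ₀ k) ^ (-t) * ((2 * Real.pi * Λ.scale ρ (ξ₀ k)) ^ j *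
          (C * Λ ξ ^ (t - ρ * j))) := by
          gcongr
          exact h1.trans (by gcongr)
      _ = C * (2 * Real.pi) ^ j *
          (Λ.scale ρ (ξ₀ k) ^ j * Λ ξ ^ (t - ρ * j) * Λ (ξ₀ k) ^ (-t)) := by
          rw [mul_pow]; ring
      _ ≤ C * (2 * Real.pi) ^ j * (D * (1 + ‖η‖) ^ N) := by
          exact mul_le_mul_of_nonneg_left (h3.trans h4) (by positivity)
      _ = _ := by ring

end Weight

/-! ### Partial derivatives of vector-valued functions -/

section ListPartial

variable {n : ℕ} {F : Type*} [NormedAddCommGroup F] [NormedSpace ℝ F]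

/-- Iterated partial derivatives along a list of coordinate directions. -/
def listPartial (l : List (Fin n)) (f : Euc n → F) : Euc n → F := l.foldr partialDeriv f

theorem contDiff_partialDeriv' {f : Euc n → F} (hf : ContDiff ℝ ∞ f) (i : Fin n) :
    ContDiff ℝ ∞ (partialDeriv i f) :=
  (hf.fderiv_right (m := ∞) (by simp)).clm_apply contDiff_const

theorem contDiff_listPartial {f : Euc n → F} (hf : ContDiff ℝ ∞ f) (l : List (Fin n)) :
    ContDiff ℝ ∞ (listPartial l f) := by
  induction l with
  | nil => exact hf
  | cons i l ih => exact contDiff_partialDeriv' ih i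

theorem partialDeriv_comm' {f : Euc n → F} (hf : ContDiff ℝ ∞ f) (i j : Fin n) :
    partialDeriv i (partialDeriv j f) = partialDeriv j (partialDeriv i f) := by
  have key : ∀ (i j : Fin n) (x : Euc n), partialDeriv i (partialDeriv j f) x =
      fderiv ℝ (fderiv ℝ f) x (EuclideanSpace.single i 1) (EuclideanSpace.single j 1) := by
    intro i j x
    have h : DifferentiableAt ℝ (fderiv ℝ f) x :=
      ((hf.fderiv_right (m := ∞) (by simp)).differentiable (by simp)).differentiableAt
    change fderiv ℝ (fun y => fderiv ℝ f y (EuclideanSpace.single j 1)) x _ = _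
    rw [fderiv_clm_apply h (differentiableAt_const _)]
    simp
  ext x
  rw [key, key]
  exact (hf.contDiffAt.isSymmSndFDerivAt
    (by simpa using WithTop.coe_le_coe.2 (le_top : (2 : ℕ∞) ≤ ⊤))) _ _

theorem listPartial_perm {f : Euc n → F} (hf : ContDiff ℝ ∞ f) {l l' : List (Fin n)}
    (h : l.Perm l') : listPartial l f = listPartial l' f := by
  induction h with
  | nil => rfl
  | cons i _ ih => exact congrArg (partialDeriv i) ih
  | swap i j l => exact partialDeriv_comm' (contDiff_listPartial hf l) j i
  | trans _ _ h₁ h₂ => exact h₁.trans h₂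

theorem multiDeriv_eq_listPartial (α : Fin n → ℕ) (f : Euc n → F) : multiDeriv α f =
    listPartial ((List.finRange n).flatMap fun i => List.replicate (α i) i) f := by
  unfold multiDeriv listPartial
  induction List.finRange n with
  | nil => rfl
  | cons i l ih =>
    rw [List.flatMap_cons, List.foldr_append, ← ih, List.foldr_cons]
    generalize l.foldr (fun i g => (partialDeriv i)^[α i] g) f = g
    induction α i with
    | zero => rfl
    | succ k ihk => rw [Function.iterate_succ_apply', ihk, List.replicate_succ, List.foldr_cons]

theorem multiDeriv_zero (f : Euc n → F) : multiDeriv 0 f = f := by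
  rw [multiDeriv_eq_listPartial, List.flatMap_eq_nil_iff.2 (by simp)]
  rfl

/-- Lists suit induction on derivatives, multi-indices appear in the symbol estimates; symmetry of
second derivatives allows the list to be sorted. -/
theorem listPartial_eq_multiDeriv {f : Euc n → F} (hf : ContDiff ℝ ∞ f) (l : List (Fin n)) :
    listPartial l f = multiDeriv (fun i => l.count i) f := by
  rw [multiDeriv_eq_listPartial]
  apply listPartial_perm hf
  rw [List.perm_iff_count]
  intro a
  simp only [List.count_flatMap, Function.comp_def, List.count_replicate]
  rw [← List.ofFn_eq_map, List.sum_ofFn]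
  simp

theorem iteratedFDeriv_single_eq_listPartial {f : Euc n → F} (hf : ContDiff ℝ ∞ f) (k : ℕ)
    (J : Fin k → Fin n) (x : Euc n) :
    iteratedFDeriv ℝ k f x (fun j => EuclideanSpace.single (J j) 1) =
      listPartial (List.ofFn J) f x := by
  induction k generalizing x with
  | zero => simp [listPartial]
  | succ k ih =>
    have hd : DifferentiableAt ℝ (iteratedFDeriv ℝ k f) x :=
      (hf.differentiable_iteratedFDeriv (by exact_mod_cast WithTop.coe_lt_top _)).differentiableAt
    rw [hd.iteratedFDeriv_succ_apply_left', List.ofFn_succ]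
    change _ = partialDeriv (J 0) (listPartial _ f) x
    rw [partialDeriv]
    congr 2
    ext y
    exact ih (fun j => J j.succ) y

theorem norm_multilinear_le_sum {k : ℕ}
    (A : ContinuousMultilinearMap ℝ (fun _ : Fin k => Euc n) F) :
    ‖A‖ ≤ ∑ J : Fin k → Fin n, ‖A (fun j => EuclideanSpace.single (J j) 1)‖ := by
  refine A.opNorm_le_bound (by positivity) fun v => ?_
  have hv : v = fun j => ∑ i, v j i • EuclideanSpace.single i (1 : ℝ) := by
    ext j i
    simp [Finset.sum_apply, Pi.single_apply]
  have hA : A v = ∑ J : Fin k → Fin n, (∏ j, v j (J j)) •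
      A (fun j => EuclideanSpace.single (J j) 1) := by
    conv_lhs => rw [hv]
    rw [A.map_sum]
    exact Finset.sum_congr rfl fun J _ => A.map_smul_univ _ _
  rw [hA, Finset.sum_mul]
  refine (norm_sum_le _ _).trans (Finset.sum_le_sum fun J _ => ?_)
  rw [norm_smul, mul_comm, norm_prod]
  gcongr with j
  exact PiLp.norm_apply_le (v j) (J j)

theorem contDiff_partial_right {σ : Euc n → Euc n → F}
    (hσ : ContDiff ℝ ∞ fun z : Euc n × Euc n => σ z.1 z.2) (i : Fin n) :
    ContDiff ℝ ∞ fun z : Euc n × Euc n => partialDeriv i (σ z.1) z.2 := by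
  have h : (fun z : Euc n × Euc n => partialDeriv i (σ z.1) z.2) = fun z =>
      fderiv ℝ (fun z : Euc n × Euc n => σ z.1 z.2) z (0, EuclideanSpace.single i 1) := by
    funext z
    have h1 : HasFDerivAt (fun z : Euc n × Euc n => σ z.1 z.2)
        (fderiv ℝ (fun z : Euc n × Euc n => σ z.1 z.2) z) (z.1, z.2) :=
      (hσ.differentiable (by simp) z).hasFDerivAt
    have h2 := h1.comp z.2 (hasFDerivAt_prodMk_right z.1 z.2)
    change fderiv ℝ (σ z.1) z.2 _ = _
    have h3 : HasFDerivAt (σ z.1) ((fderiv ℝ (fun z : Euc n × Euc n => σ z.1 z.2) z).comp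
      (ContinuousLinearMap.inr ℝ (Euc n) (Euc n))) z.2 := h2
    rw [h3.fderiv]
    rfl
  rw [h]
  exact (hσ.fderiv_right (m := ∞) (by simp)).clm_apply contDiff_const

theorem contDiff_listPartial_right {σ : Euc n → Euc n → F}
    (hσ : ContDiff ℝ ∞ fun z : Euc n × Euc n => σ z.1 z.2) (l : List (Fin n)) :
    ContDiff ℝ ∞ fun z : Euc n × Euc n => listPartial l (σ z.1) z.2 := by
  induction l with
  | nil => exact hσ
  | cons i l ih => exact contDiff_partial_right (σ := fun x => listPartial l (σ x)) ih i

end ListPartial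

/-! ### Symbols seen by a wave packet -/

section Packet

variable {n : ℕ} {Λ : WeightFunction n} {ρ m : ℝ} {σ : Euc n → Euc n → ℂ}

theorem IsSymbolM.isSymbolS (hσ : IsSymbolM Λ ρ m σ) : IsSymbolS Λ ρ m σ := by
  simpa [monomial, multiDeriv_zero] using hσ.2 0 (by simp)

theorem IsSymbolS.norm_iteratedFDeriv_le (hσ : IsSymbolS Λ ρ m σ) (l : List (Fin n)) (j : ℕ) :
    ∃ C : ℝ, 0 < C ∧ ∀ x ξ, ‖iteratedFDeriv ℝ j (fun y => listPartial l (σ y) ξ) x‖ ≤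
      C * Λ ξ ^ (m - ρ * l.length) := by
  have hl : ∀ x, ContDiff ℝ ∞ (σ x) := fun x => hσ.1.comp (contDiff_const.prodMk contDiff_id)
  have hx : ∀ ξ, ContDiff ℝ ∞ fun y => listPartial l (σ y) ξ := fun ξ =>
    (contDiff_listPartial_right hσ.1 l).comp (contDiff_id.prodMk contDiff_const)
  choose C hC h using fun α => hσ.2 α fun i => l.count i
  refine ⟨1 + ∑ J : Fin j → Fin n, C fun i => (List.ofFn J).count i, ?_, fun x ξ => ?_⟩
  · have : 0 ≤ ∑ J : Fin j → Fin n, C fun i => (List.ofFn J).count i :=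
      Finset.sum_nonneg fun J _ => (hC _).le
    linarith
  · refine (norm_multilinear_le_sum _).trans ?_
    rw [add_mul, one_mul, Finset.sum_mul]
    refine le_add_of_nonneg_of_le (Real.rpow_nonneg (Λ.pos ξ).le _)
      (Finset.sum_le_sum fun J _ => ?_)
    rw [iteratedFDeriv_single_eq_listPartial (hx ξ), listPartial_eq_multiDeriv (hx ξ)]
    have := h (fun i => (List.ofFn J).count i) x ξ
    rw [multiLength_count] at this
    simpa only [listPartial_eq_multiDeriv (hl _)] using this

variable (Λ ρ m σ)

/-- The partial derivatives in `η` of the normalized symbol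
`Λ(ξ₀)^{-m} σ(x₀ + y/λ, ξ₀ + 2πλη)`, where `λ = Λ(ξ₀)^{ρ/2}`. -/
def packetSymbol (x₀ ξ₀ : Euc n) (l : List (Fin n)) (y η : Euc n) : ℂ :=
  ((Λ ξ₀ ^ (-m) * (2 * Real.pi * Λ.scale ρ ξ₀) ^ l.length : ℝ) : ℂ) *
    listPartial l (σ (x₀ + (Λ.scale ρ ξ₀)⁻¹ • y)) (ξ₀ + (2 * Real.pi * Λ.scale ρ ξ₀) • η)

variable {Λ ρ m σ}

theorem hasFDerivAt_packetSymbol (hσ : IsSymbolS Λ ρ m σ) (x₀ ξ₀ : Euc n) (l : List (Fin n))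
    (y η : Euc n) : HasFDerivAt (packetSymbol Λ ρ m σ x₀ ξ₀ l y)
      (gradForm fun i => packetSymbol Λ ρ m σ x₀ ξ₀ (i :: l) y η) η := by
  have hl : ∀ x, ContDiff ℝ ∞ (σ x) := fun x => hσ.1.comp (contDiff_const.prodMk contDiff_id)
  set c := 2 * Real.pi * Λ.scale ρ ξ₀ with hc
  set x := x₀ + (Λ.scale ρ ξ₀)⁻¹ • y with hx
  have h1 := ((contDiff_listPartial (hl x) l).differentiable (by simp) (ξ₀ + c • η)).hasFDerivAt
  have h2 : HasFDerivAt (fun η : Euc n => ξ₀ + c • η) (c • ContinuousLinearMap.id ℝ (Euc n)) η :=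
    ((hasFDerivAt_id η).const_smul c).const_add ξ₀
  have h3 := (h1.comp η h2).const_mul ((Λ ξ₀ ^ (-m) * c ^ l.length : ℝ) : ℂ)
  refine h3.congr_fderiv ?_
  rw [fderiv_eq_gradForm (_ • _)]
  congr 1
  funext i
  simp only [packetSymbol, ← hc, ← hx, smul_apply, ContinuousLinearMap.comp_apply,
    ContinuousLinearMap.id_apply, map_smul, smul_eq_mul, Complex.real_smul, List.length_cons,
    pow_succ]
  change _ = _ * partialDeriv i (listPartial l (σ x)) (ξ₀ + c • η)
  rw [partialDeriv]
  push_cast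
  ring

theorem contDiff_packetSymbol (hσ : IsSymbolS Λ ρ m σ) (x₀ ξ₀ : Euc n) (l : List (Fin n))
    (η : Euc n) : ContDiff ℝ ∞ fun y => packetSymbol Λ ρ m σ x₀ ξ₀ l y η := by
  refine contDiff_const.mul ?_
  exact (contDiff_listPartial_right hσ.1 l).comp
    ((contDiff_const.add (contDiff_id.const_smul _)).prodMk contDiff_const)

/-- The substitution `x = x₀ + y/λ` gains a factor `1/λ` for each derivative in `y`, because
derivatives of `σ` in `x` do not change its order. -/
theorem norm_iteratedFDeriv_packetSymbol_le (hσ : IsSymbolS Λ ρ m σ)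
    (l : List (Fin n)) (j : ℕ) : ∃ C : ℝ, 0 < C ∧ ∀ x₀ ξ₀ y η : Euc n,
      ‖iteratedFDeriv ℝ j (fun y => packetSymbol Λ ρ m σ x₀ ξ₀ l y η) y‖ ≤
        C * (Λ.scale ρ ξ₀)⁻¹ ^ j * (Λ.scale ρ ξ₀ ^ l.length *
          Λ (ξ₀ + (2 * Real.pi * Λ.scale ρ ξ₀) • η) ^ (m - ρ * l.length) * Λ ξ₀ ^ (-m)) := by
  obtain ⟨C, hC, h⟩ := hσ.norm_iteratedFDeriv_le l j
  refine ⟨C * (2 * Real.pi) ^ l.length, by positivity, fun x₀ ξ₀ y η => ?_⟩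
  have hs := Λ.scale_pos ρ ξ₀
  have h0 := Λ.pos ξ₀
  set ξ := ξ₀ + (2 * Real.pi * Λ.scale ρ ξ₀) • η
  have hx : ContDiff ℝ ∞ fun y => listPartial l (σ y) ξ :=
    (contDiff_listPartial_right hσ.1 l).comp (contDiff_id.prodMk contDiff_const)
  have hx' : ContDiff ℝ ∞ fun y => listPartial l (σ (x₀ + (Λ.scale ρ ξ₀)⁻¹ • y)) ξ :=
    hx.comp (contDiff_const.add (contDiff_id.const_smul _))
  have h1 := iteratedFDeriv_comp_affine_norm_le hx x₀ (Λ.scale ρ ξ₀)⁻¹ j y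
  rw [abs_of_pos (by positivity)] at h1
  have h2 := h1.trans (mul_le_mul_of_nonneg_left (h (x₀ + (Λ.scale ρ ξ₀)⁻¹ • y) ξ) (by positivity))
  have h3 : ‖iteratedFDeriv ℝ j (fun y => packetSymbol Λ ρ m σ x₀ ξ₀ l y η) y‖ =
      (Λ ξ₀ ^ (-m) * (2 * Real.pi * Λ.scale ρ ξ₀) ^ l.length) *
        ‖iteratedFDeriv ℝ j (fun y => listPartial l (σ (x₀ + (Λ.scale ρ ξ₀)⁻¹ • y)) ξ) y‖ := by
    change ‖iteratedFDeriv ℝ j (fun y => ((Λ ξ₀ ^ (-m) * (2 * Real.pi * Λ.scale ρ ξ₀) ^ l.length :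
      ℝ) : ℂ) • listPartial l (σ (x₀ + (Λ.scale ρ ξ₀)⁻¹ • y)) ξ) y‖ = _
    rw [iteratedFDeriv_const_smul_apply' (contDiff_infty.1 hx' _).contDiffAt, norm_smul,
      Complex.norm_real, Real.norm_of_nonneg (by positivity)]
  rw [h3]
  refine (mul_le_mul_of_nonneg_left h2 (by positivity)).trans (le_of_eq ?_)
  rw [mul_pow]
  ring

/-- The frequency `η` is made part of the index, so that one polynomial weight in `η` controls all
derivatives in `y` uniformly in `k`. -/
theorem packetSymbol_temperate (hσ : IsSymbolS Λ ρ m σ) (hρ0 : 0 < ρ) (hρ : ρ ≤ 1 / Λ.μ)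
    {κ : Type*} (x₀ : κ → Euc n) {ξ₀ : κ → Euc n} (h : ∀ k, 1 ≤ Λ (ξ₀ k)) (l : List (Fin n)) :
    ∃ N : ℕ, TemperateBoundedBy (fun q : κ × Euc n => (1 + ‖q.2‖) ^ N)
      fun q y => packetSymbol Λ ρ m σ (x₀ q.1) (ξ₀ q.1) l y q.2 := by
  obtain ⟨N, D, hD, hr⟩ := Λ.ratio_rpow_le hρ0 hρ (m - ρ * l.length)
  refine ⟨N, fun q => contDiff_packetSymbol hσ _ _ l _, fun j => ?_⟩
  obtain ⟨C, hC, hb⟩ := norm_iteratedFDeriv_packetSymbol_le hσ l j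
  refine ⟨0, C * D, fun q y => (hb _ _ _ _).trans ?_⟩
  have h1 := (Λ.scale_pow_mul_le hρ0 (h q.1) l.length m
    (ξ₀ q.1 + (2 * Real.pi * Λ.scale ρ (ξ₀ q.1)) • q.2)).trans (hr _ q.2 (h q.1))
  have h2 : (Λ.scale ρ (ξ₀ q.1))⁻¹ ^ j ≤ 1 :=
    pow_le_one₀ (by have := Λ.scale_pos ρ (ξ₀ q.1); positivity)
      (inv_le_one_of_one_le₀ (Λ.one_le_scale hρ0 (h q.1)))
  have hs := Λ.scale_pos ρ (ξ₀ q.1)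
  rw [pow_zero, mul_one, mul_assoc C D]
  refine mul_le_mul (mul_le_of_le_one_right hC.le h2) h1 ?_ hC.le
  have := Λ.pos (ξ₀ q.1)
  have := Λ.pos (ξ₀ q.1 + (2 * Real.pi * Λ.scale ρ (ξ₀ q.1)) • q.2)
  positivity

/-- Freezing the symbol at the centre of the packet. Both mean value estimates, in `y` and in `η`,
gain `1/λ`: a derivative in `y` carries `1/λ`, and a derivative in `η` carries `λ Λ^{-ρ}`,
comparable to `1/λ` up to a polynomial in `η`. This balance dictates the scale `λ = Λ(ξ₀)^{ρ/2}`. -/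
theorem packetSymbol_sub_le (hσ : IsSymbolS Λ ρ m σ) (hρ0 : 0 < ρ) (hρ : ρ ≤ 1 / Λ.μ) :
    ∃ (N : ℕ) (C : ℝ), 0 < C ∧ ∀ x₀ ξ₀ y η : Euc n, 1 ≤ Λ ξ₀ →
      ‖packetSymbol Λ ρ m σ x₀ ξ₀ [] y η - packetSymbol Λ ρ m σ x₀ ξ₀ [] 0 0‖ ≤
        (Λ.scale ρ ξ₀)⁻¹ * (C * (1 + ‖η‖) ^ N * (‖y‖ + ‖η‖)) := by
  obtain ⟨C₁, hC₁, hb₁⟩ := norm_iteratedFDeriv_packetSymbol_le hσ [] 1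
  choose C₂ hC₂ hb₂ using fun i : Fin n => norm_iteratedFDeriv_packetSymbol_le hσ [i] 0
  obtain ⟨N₁, D₁, hD₁, hr₁⟩ := Λ.ratio_rpow_le hρ0 hρ m
  obtain ⟨N₂, D₂, hD₂, hr₂⟩ := Λ.ratio_rpow_le hρ0 hρ (m - ρ)
  have hS : 0 ≤ ∑ i, C₂ i := Finset.sum_nonneg fun i _ => (hC₂ i).le
  refine ⟨max N₁ N₂, C₁ * D₁ + (∑ i, C₂ i) * D₂, by positivity, fun x₀ ξ₀ y η h => ?_⟩
  have hs := Λ.scale_pos ρ ξ₀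
  have h0 := Λ.pos ξ₀
  have hη : (1 : ℝ) ≤ 1 + ‖η‖ := by simp
  have hy : ‖packetSymbol Λ ρ m σ x₀ ξ₀ [] y η - packetSymbol Λ ρ m σ x₀ ξ₀ [] 0 η‖ ≤
      (C₁ * (Λ.scale ρ ξ₀)⁻¹ * (D₁ * (1 + ‖η‖) ^ N₁)) * ‖y - 0‖ := by
    refine convex_univ.norm_image_sub_le_of_norm_fderiv_le (𝕜 := ℝ)
      (f := fun y => packetSymbol Λ ρ m σ x₀ ξ₀ [] y η)
      (fun y _ => (contDiff_packetSymbol hσ _ _ _ _).differentiable (by simp) y) (fun y _ => ?_)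
      (Set.mem_univ _) (Set.mem_univ _)
    have h1 := hb₁ x₀ ξ₀ y η
    have h2 := (Λ.scale_pow_mul_le hρ0 h 0 m (ξ₀ + (2 * Real.pi * Λ.scale ρ ξ₀) • η))
    simp only [pow_zero, CharP.cast_eq_zero, mul_zero, sub_zero] at h2
    have h2' := h2.trans (hr₁ ξ₀ η h)
    simp only [norm_iteratedFDeriv_one, List.length_nil, pow_zero, CharP.cast_eq_zero, mul_zero,
      sub_zero, pow_one] at h1
    exact h1.trans (mul_le_mul_of_nonneg_left h2' (by positivity))
  have hη' : ‖packetSymbol Λ ρ m σ x₀ ξ₀ [] 0 η - packetSymbol Λ ρ m σ x₀ ξ₀ [] 0 0‖ ≤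
      (∑ i, C₂ i) * (Λ.scale ρ ξ₀)⁻¹ * (D₂ * (1 + ‖η‖) ^ N₂) * ‖η - 0‖ := by
    -- A ball around the origin suffices, since the derivative bound is increasing in `‖η'‖`.
    refine (convex_closedBall (0 : Euc n) ‖η‖).norm_image_sub_le_of_norm_hasFDerivWithin_le
      (𝕜 := ℝ) (fun η' _ => (hasFDerivAt_packetSymbol hσ x₀ ξ₀ [] 0 η').hasFDerivWithinAt)
      (fun η' hη' => ?_) (by simp) (by simp)
    have hη'' : ‖η'‖ ≤ ‖η‖ := by simpa using hη'
    refine (norm_gradForm_le _).trans ?_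
    rw [mul_assoc, Finset.sum_mul]
    refine Finset.sum_le_sum fun i _ => ?_
    have h1 := hb₂ i x₀ ξ₀ 0 η'
    simp only [norm_iteratedFDeriv_zero, List.length_singleton, pow_zero, Nat.cast_one, mul_one,
      pow_one] at h1
    refine h1.trans (mul_le_mul_of_nonneg_left ?_ (hC₂ i).le)
    have h2 := (hr₂ ξ₀ η' h).trans (show _ ≤ D₂ * (1 + ‖η‖) ^ N₂ by gcongr)
    refine le_trans (le_of_eq ?_) (mul_le_mul_of_nonneg_left h2 (inv_nonneg.2 hs.le))
    set ξ := ξ₀ + (2 * Real.pi * Λ.scale ρ ξ₀) • η'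
    -- Here `λ² = Λ(ξ₀)^ρ` turns the factor `λ` of the chain rule into `λ⁻¹` times a power of the
    -- ratio of weights.
    rw [Real.div_rpow (Λ.pos _).le h0.le, Real.rpow_sub h0, ← Λ.scale_mul_self ρ ξ₀,
      Real.rpow_neg h0.le]
    field_simp
  have e1 : (1 + ‖η‖) ^ N₁ ≤ (1 + ‖η‖) ^ max N₁ N₂ := pow_le_pow_right₀ hη (le_max_left _ _)
  have e2 : (1 + ‖η‖) ^ N₂ ≤ (1 + ‖η‖) ^ max N₁ N₂ := pow_le_pow_right₀ hη (le_max_right _ _)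
  rw [sub_zero] at hy hη'
  calc _ ≤ (C₁ * (Λ.scale ρ ξ₀)⁻¹ * (D₁ * (1 + ‖η‖) ^ N₁)) * ‖y‖ +
        (∑ i, C₂ i) * (Λ.scale ρ ξ₀)⁻¹ * (D₂ * (1 + ‖η‖) ^ N₂) * ‖η‖ :=
        (norm_sub_le_norm_sub_add_norm_sub _ _ _).trans (add_le_add hy hη')
    _ ≤ (C₁ * (Λ.scale ρ ξ₀)⁻¹ * (D₁ * (1 + ‖η‖) ^ max N₁ N₂)) * ‖y‖ +
        (∑ i, C₂ i) * (Λ.scale ρ ξ₀)⁻¹ * (D₂ * (1 + ‖η‖) ^ max N₁ N₂) * ‖η‖ := by gcongr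
    _ ≤ (C₁ * (Λ.scale ρ ξ₀)⁻¹ * (D₁ * (1 + ‖η‖) ^ max N₁ N₂)) * (‖y‖ + ‖η‖) +
        (∑ i, C₂ i) * (Λ.scale ρ ξ₀)⁻¹ * (D₂ * (1 + ‖η‖) ^ max N₁ N₂) * (‖y‖ + ‖η‖) := by
        gcongr <;> linarith [norm_nonneg y, norm_nonneg η]
    _ = _ := by ring

variable (Λ ρ m σ)

/-- The amplitude `η ↦ τ(·, η) f`, where `τ` is the normalized symbol of a wave packet. -/
def packetAmplitude {κ : Type*} (x₀ ξ₀ : κ → Euc n) (f : κ → 𝓢(Euc n, ℂ)) (l : List (Fin n))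
    (k : κ) (η : Euc n) : 𝓢(Euc n, ℂ) :=
  SchwartzMap.smulLeftCLM ℂ (fun y => packetSymbol Λ ρ m σ (x₀ k) (ξ₀ k) l y η) (f k)

variable {Λ ρ m σ}

theorem packetAmplitude_apply (hσ : IsSymbolS Λ ρ m σ) (hρ0 : 0 < ρ) (hρ : ρ ≤ 1 / Λ.μ)
    {κ : Type*} (x₀ : κ → Euc n) {ξ₀ : κ → Euc n} (h : ∀ k, 1 ≤ Λ (ξ₀ k))
    (f : κ → 𝓢(Euc n, ℂ)) (l : List (Fin n)) (k : κ) (η y : Euc n) :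
    packetAmplitude Λ ρ m σ x₀ ξ₀ f l k η y =
      packetSymbol Λ ρ m σ (x₀ k) (ξ₀ k) l y η * f k y := by
  obtain ⟨N, hN⟩ := packetSymbol_temperate hσ hρ0 hρ x₀ h l
  exact SchwartzMap.smulLeftCLM_apply_apply (hN.hasTemperateGrowth (k, η)) _ _

theorem isAmplitude_packetAmplitude (hσ : IsSymbolS Λ ρ m σ) (hρ0 : 0 < ρ) (hρ : ρ ≤ 1 / Λ.μ)
    {κ : Type*} (x₀ : κ → Euc n) {ξ₀ : κ → Euc n} (h : ∀ k, 1 ≤ Λ (ξ₀ k))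
    {f : κ → 𝓢(Euc n, ℂ)} (hf : SchwartzBoundedBy (fun _ => 1) f) :
    IsAmplitude (packetAmplitude Λ ρ m σ x₀ ξ₀ f) where
  bound l := by
    obtain ⟨N, hN⟩ := packetSymbol_temperate hσ hρ0 hρ x₀ h l
    refine ⟨N, ?_⟩
    have := (hf.comp (Prod.fst : κ × Euc n → κ)).smulLeft hN
    simp only [mul_one] at this
    exact this
  deriv l k y η := by
    simp only [packetAmplitude_apply hσ hρ0 hρ x₀ h]
    have := (hasFDerivAt_packetSymbol hσ (x₀ k) (ξ₀ k) l y η).mul_const (f k y)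
    refine this.congr_fderiv ?_
    rw [← gradForm_const_mul]
    congr 1
    funext i
    ring

end Packet

/-! ### Wave packets -/

section WavePacket

variable {n : ℕ}

theorem hasTemperateGrowth_cexp_mul_I :
    Function.HasTemperateGrowth fun t : ℝ => Complex.exp ((t : ℂ) * Complex.I) := by
  have hd : ∀ k, iteratedDeriv k (fun t : ℝ => Complex.exp ((t : ℂ) * Complex.I)) =
      fun t : ℝ => Complex.exp ((t : ℂ) * Complex.I) * Complex.I ^ k := by
    intro k
    induction k with
    | zero => simp
    | succ k ih =>
      rw [iteratedDeriv_succ, ih]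
      funext t
      have h := (((hasDerivAt_id t).ofReal_comp.mul_const Complex.I).cexp).mul_const
        (Complex.I ^ k)
      simp only [id_eq] at h
      rw [h.deriv]
      push_cast
      ring
  refine ⟨?_, fun k => ⟨0, 1, fun t => ?_⟩⟩
  · exact ((Complex.ofRealCLM.contDiff.mul contDiff_const).cexp : ContDiff ℝ ∞ _)
  · rw [norm_iteratedFDeriv_eq_norm_iteratedDeriv, hd]
    simp [Complex.norm_exp_ofReal_mul_I]

theorem hasTemperateGrowth_character (x₀ : Euc n) : (character x₀).HasTemperateGrowth :=
  hasTemperateGrowth_cexp_mul_I.comp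
    (((2 * Real.pi) • (innerSL ℝ x₀ : Euc n →L[ℝ] ℝ)).hasTemperateGrowth)

theorem character_add (x η η' : Euc n) : character x (η + η') = character x η * character x η' := by
  rw [character, character, character, ← Complex.exp_add, inner_add_right]
  push_cast
  ring_nf

theorem character_add_left (x x' η : Euc n) :
    character (x + x') η = character x η * character x' η := by
  rw [character, character, character, ← Complex.exp_add, inner_add_left]
  push_cast
  ring_nf

theorem character_smul_left (c : ℝ) (x η : Euc n) :
    character (c • x) η = character x (c • η) := by
  rw [character, character, real_inner_smul_left, real_inner_smul_right]

theorem fourier_eq_character (f : 𝓢(Euc n, ℂ)) (x : Euc n) :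
    𝓕 f x = ∫ ζ, character ζ (-x) * f ζ := by
  rw [SchwartzMap.fourier_coe, Real.fourier_eq']
  refine integral_congr_ae (ae_of_all _ fun ζ => ?_)
  simp only [character, inner_neg_right, smul_eq_mul]
  congr 3
  push_cast
  ring

/-- The integral is invariant, up to the factor `c^n`, under the substitution `x = a + c y`. -/
theorem integral_comp_affine (f : Euc n → ℂ) (a : Euc n) {c : ℝ} (hc : 0 < c) :
    ∫ x, f x = ((c ^ n : ℝ) : ℂ) * ∫ y, f (a + c • y) := by
  have h := Measure.integral_comp_smul_of_nonneg (volume : Measure (Euc n))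
    (fun x => f (a + x)) c (hR := hc.le)
  rw [h, integral_add_left_eq_self f a, finrank_euclideanSpace_fin, Complex.real_smul, ← mul_assoc,
    ← Complex.ofReal_mul, mul_inv_cancel₀ (by positivity)]
  simp

theorem antilipschitz_rescale (ζ₀ : Euc n) {c : ℝ} (hc : 0 < c) :
    AntilipschitzWith (Real.toNNReal c) fun ζ : Euc n => c⁻¹ • (ζ - ζ₀) := by
  refine AntilipschitzWith.of_le_mul_dist fun x y => ?_
  rw [dist_eq_norm, dist_eq_norm, ← smul_sub, sub_sub_sub_cancel_right, norm_smul,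
    Real.coe_toNNReal _ hc.le, Real.norm_of_nonneg (by positivity), ← mul_assoc,
    mul_inv_cancel₀ hc.ne', one_mul]

/-- The map `F ↦ e^{2πi x₀·ζ} F((ζ - ζ₀) / c)`: on the Fourier side, it localizes at the point
`(x₀, ζ₀)` of phase space. -/
def wavePacket (x₀ ζ₀ : Euc n) {c : ℝ} (hc : 0 < c) : 𝓢(Euc n, ℂ) →L[ℂ] 𝓢(Euc n, ℂ) :=
  SchwartzMap.smulLeftCLM ℂ (character x₀) ∘L
    SchwartzMap.compCLMOfAntilipschitz ℂ (g := fun ζ : Euc n => c⁻¹ • (ζ - ζ₀))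
      (by fun_prop) (antilipschitz_rescale ζ₀ hc)

theorem wavePacket_apply (x₀ ζ₀ : Euc n) {c : ℝ} (hc : 0 < c) (f : 𝓢(Euc n, ℂ)) (ζ : Euc n) :
    wavePacket x₀ ζ₀ hc f ζ = character x₀ ζ * f (c⁻¹ • (ζ - ζ₀)) := by
  simp [wavePacket, SchwartzMap.smulLeftCLM_apply_apply (hasTemperateGrowth_character x₀)]

/-- On the other side of the Fourier transform the packet sits at `x₀` with width `1/c`, which gives
its `L^q` norms by scaling. -/
theorem fourier_wavePacket (x₀ ζ₀ : Euc n) {c : ℝ} (hc : 0 < c) (f : 𝓢(Euc n, ℂ)) (x : Euc n) :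
    𝓕 (wavePacket x₀ ζ₀ hc f) x =
      ((c ^ n : ℝ) : ℂ) * (character (x - x₀) (-ζ₀) * 𝓕 f (c • (x - x₀))) := by
  rw [fourier_eq_character, fourier_eq_character, integral_comp_affine _ ζ₀ hc]
  congr 1
  rw [← integral_const_mul]
  refine integral_congr_ae (ae_of_all _ fun η => ?_)
  beta_reduce
  rw [wavePacket_apply, add_sub_cancel_left, smul_smul, inv_mul_cancel₀ hc.ne', one_smul,
    ← mul_assoc, ← mul_assoc]
  congr 1
  simp only [character]
  rw [← Complex.exp_add, ← Complex.exp_add, real_inner_comm _ x₀, real_inner_comm _ (x - x₀)]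
  congr 1
  simp only [inner_add_left, inner_neg_right, inner_neg_left, real_inner_smul_left,
    real_inner_smul_right, inner_sub_right]
  push_cast
  ring

theorem norm_fourier_wavePacket (x₀ ζ₀ : Euc n) {c : ℝ} (hc : 0 < c) (f : 𝓢(Euc n, ℂ))
    (x : Euc n) : ‖𝓕 (wavePacket x₀ ζ₀ hc f) x‖ = c ^ n * ‖𝓕 f (c • (x - x₀))‖ := by
  rw [fourier_wavePacket, norm_mul, norm_mul, norm_character, one_mul, Complex.norm_real,
    Real.norm_of_nonneg (by positivity)]

end WavePacket

/-! ### The formal adjoint of a pseudo-differential operator -/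

section Adjoint

variable {n : ℕ} {Λ : WeightFunction n} {ρ m : ℝ} {σ : Euc n → Euc n → ℂ}

theorem fourierHat_two_pi_smul (φ : 𝓢(Euc n, ℂ)) (ζ : Euc n) :
    fourierHat φ ((2 * Real.pi) • ζ) = (((2 * Real.pi) ^ (-(n : ℝ) / 2) : ℝ) : ℂ) * 𝓕 φ ζ := by
  rw [fourierHat, fourier_eq_character]
  congr 1
  refine integral_congr_ae (ae_of_all _ fun x => ?_)
  simp only [character, inner_neg_right, real_inner_smul_right]
  congr 2
  push_cast
  ring

/-- Under `ξ = 2πζ` the Jacobian `(2π)^n` cancels the two normalizing factors `(2π)^{-n/2}`. -/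
theorem pseudoDiff_eq (σ : Euc n → Euc n → ℂ) (φ : 𝓢(Euc n, ℂ)) (x : Euc n) :
    pseudoDiff σ φ x = ∫ ζ, character x ζ * σ x ((2 * Real.pi) • ζ) * 𝓕 φ ζ := by
  rw [pseudoDiff, integral_comp_affine _ 0 Real.two_pi_pos, ← integral_const_mul,
    ← integral_const_mul]
  refine integral_congr_ae (ae_of_all _ fun ζ => ?_)
  beta_reduce
  rw [zero_add, fourierHat_two_pi_smul]
  have h1 : ((2 * Real.pi) ^ (-(n : ℝ) / 2) : ℝ) * ((2 * Real.pi) ^ n : ℝ) *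
      ((2 * Real.pi) ^ (-(n : ℝ) / 2) : ℝ) = 1 := by
    rw [← Real.rpow_natCast, ← Real.rpow_add Real.two_pi_pos, ← Real.rpow_add Real.two_pi_pos]
    convert Real.rpow_zero _ using 2
    ring
  have h2 : Complex.exp (Complex.I * ((inner ℝ x ((2 * Real.pi) • ζ) : ℝ) : ℂ)) =
      character x ζ := by
    rw [character, real_inner_smul_right, mul_comm]
  have h3 := congrArg (fun r : ℝ => (r : ℂ)) h1
  simp only [Complex.ofReal_mul, Complex.ofReal_one] at h3
  rw [h2]
  linear_combination (character x ζ * σ x ((2 * Real.pi) • ζ) * 𝓕 φ ζ) * h3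

theorem schwartzConj_apply (f : 𝓢(Euc n, ℂ)) (x : Euc n) : schwartzConj f x = conj (f x) := rfl

theorem schwartzConj_schwartzConj (f : 𝓢(Euc n, ℂ)) : schwartzConj (schwartzConj f) = f := by
  ext x
  simp [schwartzConj_apply]

/-- Testing with `φ = χ - χ'` gives `∫ |χ - χ'|² = 0`. -/
theorem IsFormalAdjointAt.unique {ψ χ χ' : 𝓢(Euc n, ℂ)} (h : IsFormalAdjointAt σ ψ χ)
    (h' : IsFormalAdjointAt σ ψ χ') : χ = χ' := by
  have hint : ∀ φ χ : 𝓢(Euc n, ℂ), Integrable fun x => φ x * conj (χ x) := fun φ χ =>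
    (schwartzConj χ).integrable.bdd_mul (c := SchwartzMap.seminorm ℂ 0 0 φ)
      φ.continuous.aestronglyMeasurable (ae_of_all _ fun x => φ.norm_le_seminorm ℂ x)
  have h1 := (h (χ - χ')).symm.trans (h' (χ - χ'))
  rw [← sub_eq_zero, ← integral_sub (hint _ _) (hint _ _)] at h1
  have h2 : ∫ x, ‖(χ - χ') x‖ ^ 2 = 0 := by
    have : ∀ x, (χ - χ') x * conj (χ x) - (χ - χ') x * conj (χ' x) =
        ((‖(χ - χ') x‖ ^ 2 : ℝ) : ℂ) := fun x => by
      rw [← mul_sub, ← map_sub, ← sub_apply, Complex.mul_conj, Complex.normSq_eq_norm_sq]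
    simp only [this] at h1
    rw [integral_complex_ofReal] at h1
    exact_mod_cast h1
  have hc : Continuous fun x => ‖(χ - χ') x‖ ^ 2 := (χ - χ').continuous.norm.pow 2
  have hi : Integrable fun x => ‖(χ - χ') x‖ ^ 2 := by
    have := (hint (χ - χ') (χ - χ')).norm
    refine this.congr (ae_of_all _ fun x => ?_)
    simp only [norm_mul, RCLike.norm_conj, pow_two]
  rw [integral_eq_zero_iff_of_nonneg (fun x => by positivity) hi] at h2
  have h3 := (hc.ae_eq_iff_eq volume continuous_const).1 h2
  ext x
  have h4 := congrFun h3 x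
  exact sub_eq_zero.1 (norm_eq_zero.1 (pow_eq_zero_iff two_ne_zero |>.1 h4))

/-- By uniqueness, any Schwartz function satisfying the adjoint identity is the chosen value. The
adjoint is thus computed wherever an explicit candidate is at hand, and its existence on the whole
Schwartz space is not needed. -/
theorem formalAdjoint_eq {ψ χ : 𝓢(Euc n, ℂ)} (h : IsFormalAdjointAt σ ψ χ) :
    formalAdjoint σ ψ = χ := by
  have hex : ∃ χ, IsFormalAdjointAt σ ψ χ := ⟨χ, h⟩
  rw [formalAdjoint, dif_pos hex]
  exact hex.choose_spec.unique h

theorem IsSymbolS.norm_le (hσ : IsSymbolS Λ ρ m σ) :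
    ∃ C : ℝ, 0 < C ∧ ∀ x ξ, ‖σ x ξ‖ ≤ C * Λ ξ ^ m := by
  obtain ⟨C, hC, h⟩ := hσ.norm_iteratedFDeriv_le [] 0
  refine ⟨C, hC, fun x ξ => ?_⟩
  simpa [listPartial] using h x ξ

/-- If `g(ζ) = ∫ e^{2πi x·ζ} σ(x, 2πζ) f(x) dx` is a Schwartz function, then the transpose of `T_σ`
maps `f` to the Fourier transform of `g`. -/
theorem conj_formalAdjoint_conj (hσ : IsSymbolS Λ ρ m σ) {f g : 𝓢(Euc n, ℂ)}
    (hg : ∀ ζ, g ζ = ∫ x, character x ζ * σ x ((2 * Real.pi) • ζ) * f x) :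
    schwartzConj (formalAdjoint σ (schwartzConj f)) = 𝓕 g := by
  rw [← schwartzConj_schwartzConj (𝓕 g)]
  congr 1
  refine formalAdjoint_eq fun φ => ?_
  simp only [schwartzConj_apply, Complex.conj_conj]
  rw [← SchwartzMap.integral_fourier_mul_eq]
  simp only [pseudoDiff_eq, hg, ← integral_mul_const, ← integral_const_mul]
  rw [integral_integral_swap]
  · refine integral_congr_ae (ae_of_all _ fun ζ => ?_)
    refine integral_congr_ae (ae_of_all _ fun x => ?_)
    beta_reduce
    ring
  -- Fubini's theorem applies because the growth `Λ^m` of the symbol is absorbed by the Schwartz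
  -- function `𝓕 φ`.
  · obtain ⟨C, hC, hb⟩ := hσ.norm_le
    have h1 := (f.integrable (μ := volume)).norm.mul_prod
      ((SchwartzMap.smulLeftCLM ℂ (Λ.rescaledPow m) (𝓕 φ)).integrable (μ := volume)).norm
    refine (h1.const_mul C).mono' ?_ (ae_of_all _ fun z => ?_)
    · refine Continuous.aestronglyMeasurable ?_
      have h2 : Continuous fun z : Euc n × Euc n => σ z.1 ((2 * Real.pi) • z.2) :=
        hσ.1.continuous.comp (continuous_fst.prodMk (continuous_snd.const_smul (2 * Real.pi)))
      have h3 : Continuous fun z : Euc n × Euc n => character z.1 z.2 := by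
        unfold character
        fun_prop
      exact ((h3.mul h2).mul ((𝓕 φ).continuous.comp continuous_snd)).mul
        (f.continuous.comp continuous_fst)
    · simp only [Function.uncurry]
      rw [SchwartzMap.smulLeftCLM_apply_apply (Λ.hasTemperateGrowth_rescaledPow m), norm_mul,
        norm_mul, norm_mul, norm_character, one_mul, norm_smul, WeightFunction.rescaledPow,
        Complex.norm_real, Real.norm_of_nonneg (Real.rpow_nonneg (Λ.pos _).le _)]
      calc _ ≤ C * Λ ((2 * Real.pi) • z.2) ^ m * ‖𝓕 φ z.2‖ * ‖f z.1‖ := by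
            gcongr
            exact hb _ _
        _ = _ := by ring

end Adjoint

/-! ### Action of the operators on wave packets -/

section PacketPairing

variable {n : ℕ} {Λ : WeightFunction n} {ρ m s : ℝ} {σ : Euc n → Euc n → ℂ}

variable (Λ ρ) in
/-- The wave packet operator at `(x₀, ξ₀)` with the frequency scale `Λ(ξ₀)^{ρ/2}`, for the weight
`Λ` and the normalization `ξ = 2πζ` of the frequency. -/
def packetOp (x₀ ξ₀ : Euc n) : 𝓢(Euc n, ℂ) →L[ℂ] 𝓢(Euc n, ℂ) :=
  wavePacket x₀ ((2 * Real.pi)⁻¹ • ξ₀) (Λ.scale_pos ρ ξ₀)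

theorem two_pi_smul_eq {ξ₀ ζ : Euc n} {c : ℝ} (hc : 0 < c) :
    ξ₀ + (2 * Real.pi * c) • c⁻¹ • (ζ - (2 * Real.pi)⁻¹ • ξ₀) = (2 * Real.pi) • ζ := by
  have h1 : 2 * Real.pi * c * c⁻¹ = 2 * Real.pi := by field_simp
  rw [smul_smul, h1, smul_sub, smul_smul, mul_inv_cancel₀ Real.two_pi_pos.ne', one_smul]
  abel

/-- Conjugating a weight power by the packet operator leaves its value at the centre times a
multiplier with uniform bounds. -/
theorem smulLeft_rescaledPow_packetOp (hρ0 : 0 < ρ) (hρ : ρ ≤ 1 / Λ.μ) (t : ℝ) (x₀ : Euc n)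
    {ξ₀ : Euc n} (h : 1 ≤ Λ ξ₀) (f : 𝓢(Euc n, ℂ)) :
    SchwartzMap.smulLeftCLM ℂ (Λ.rescaledPow t) (packetOp Λ ρ x₀ ξ₀ f) =
      ((Λ ξ₀ ^ t : ℝ) : ℂ) •
        packetOp Λ ρ x₀ ξ₀ (SchwartzMap.smulLeftCLM ℂ (Λ.packetPow ρ t ξ₀) f) := by
  have hp : (Λ.packetPow ρ t ξ₀).HasTemperateGrowth :=
    (Λ.packetPow_temperate hρ0 hρ t (κ := Unit) (ξ₀ := fun _ => ξ₀) fun _ => h).hasTemperateGrowth ()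
  ext ζ
  rw [SchwartzMap.smulLeftCLM_apply_apply (Λ.hasTemperateGrowth_rescaledPow t), smul_apply,
    packetOp, wavePacket_apply, wavePacket_apply, SchwartzMap.smulLeftCLM_apply_apply hp,
    WeightFunction.packetPow, two_pi_smul_eq (Λ.scale_pos ρ ξ₀), WeightFunction.rescaledPow,
    Real.div_rpow (Λ.pos _).le (Λ.pos _).le]
  have h0 : ((Λ ξ₀ ^ t : ℝ) : ℂ) ≠ 0 := by
    exact_mod_cast (Real.rpow_pos_of_pos (Λ.pos ξ₀) t).ne'
  simp only [smul_eq_mul]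
  push_cast
  field_simp

/-- The substitution `x = x₀ + y/λ` splits the phase into the character at `x₀`, which belongs to
the packet, and `e^{2πi y·η}` with `η = (ζ - ζ₀)/λ`, where `ζ₀ = ξ₀/(2π)`; the latter is the phase
of the oscillatory integral. -/
theorem packetOp_oscInt (hσ : IsSymbolS Λ ρ m σ) (hρ0 : 0 < ρ) (hρ : ρ ≤ 1 / Λ.μ) {κ : Type*}
    (x₀ : κ → Euc n) {ξ₀ : κ → Euc n} (h : ∀ k, 1 ≤ Λ (ξ₀ k)) (Φ G : κ → 𝓢(Euc n, ℂ))
    (hG : ∀ k η, G k η = oscInt (packetAmplitude Λ ρ m σ x₀ ξ₀ fun k => 𝓕 (Φ k)) k η)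
    (k : κ) (ζ : Euc n) :
    ((Λ (ξ₀ k) ^ m : ℝ) : ℂ) * packetOp Λ ρ (x₀ k) (ξ₀ k) (G k) ζ =
      ∫ x, character x ζ * σ x ((2 * Real.pi) • ζ) * 𝓕 (packetOp Λ ρ (x₀ k) (ξ₀ k) (Φ k)) x := by
  have hs := Λ.scale_pos ρ (ξ₀ k)
  have h0 : ((Λ (ξ₀ k) ^ m : ℝ) : ℂ) ≠ 0 := by
    exact_mod_cast (Real.rpow_pos_of_pos (Λ.pos (ξ₀ k)) m).ne'
  have hcn : ((Λ.scale ρ (ξ₀ k) : ℝ) : ℂ) ≠ 0 := by exact_mod_cast hs.ne'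
  rw [integral_comp_affine _ (x₀ k) (inv_pos.2 hs), packetOp, wavePacket_apply, hG, oscInt,
    ← integral_const_mul, ← integral_const_mul, ← integral_const_mul]
  refine integral_congr_ae (ae_of_all _ fun y => ?_)
  beta_reduce
  rw [packetAmplitude_apply hσ hρ0 hρ x₀ h, packetSymbol, two_pi_smul_eq hs,
    fourier_wavePacket, add_sub_cancel_left, smul_smul, mul_inv_cancel₀ hs.ne', one_smul,
    character_add_left, sub_eq_add_neg ζ, smul_add, character_add, ← character_smul_left,
    ← character_smul_left, listPartial, List.foldr_nil, List.length_nil, pow_zero, mul_one,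
    Real.rpow_neg (Λ.pos _).le, inv_pow]
  push_cast
  field_simp

/-- On wave packets, the transpose of the operator `T` is given by an oscillatory integral. -/
theorem pairing_packet (hσ : IsSymbolS Λ ρ m σ) (hρ0 : 0 < ρ) (hρ : ρ ≤ 1 / Λ.μ) {p : ℝ≥0∞}
    [Fact (1 ≤ p)] {T : SobolevSpace Λ s p →L[ℂ] SobolevSpace Λ (s - m) p}
    (hT : IsPseudoDiffOn σ T) {κ : Type*} (x₀ : κ → Euc n) {ξ₀ : κ → Euc n}
    (h : ∀ k, 1 ≤ Λ (ξ₀ k)) (Ψ : 𝓢(Euc n, ℂ)) (G : κ → 𝓢(Euc n, ℂ))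
    (hG : ∀ k η, G k η = oscInt (packetAmplitude Λ ρ m σ x₀ ξ₀ fun k =>
      𝓕 (SchwartzMap.smulLeftCLM ℂ (Λ.packetPow ρ (s - m) (ξ₀ k)) Ψ)) k η)
    (k : κ) (u : SobolevSpace Λ s p) :
    besselJ Λ (-(s - m)) (SobolevSpace.toDistribution Λ (s - m) p (T u))
        (𝓕 (packetOp Λ ρ (x₀ k) (ξ₀ k) Ψ)) =
      besselJ Λ (-s) (SobolevSpace.toDistribution Λ s p u) (𝓕 (packetOp Λ ρ (x₀ k) (ξ₀ k)
        (SchwartzMap.smulLeftCLM ℂ (Λ.packetPow ρ (-s) (ξ₀ k)) (G k)))) := by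
  have hb : ∀ (t : ℝ) (w : 𝓢'(Euc n, ℂ)) (f : 𝓢(Euc n, ℂ)), besselJ Λ (-t) w (𝓕 f) =
      w (𝓕 (SchwartzMap.smulLeftCLM ℂ (Λ.rescaledPow t) f)) := fun t w f => by
    rw [besselJ, neg_neg, TemperedDistribution.fourierMultiplierCLM_apply_apply]
    simp
  have hs : ((Λ (ξ₀ k) ^ s : ℝ) : ℂ) =
      ((Λ (ξ₀ k) ^ (s - m) : ℝ) : ℂ) * ((Λ (ξ₀ k) ^ m : ℝ) : ℂ) := by
    rw [← Complex.ofReal_mul, ← Real.rpow_add (Λ.pos _), sub_add_cancel]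
  have hp : ∀ t, (Λ.packetPow ρ t (ξ₀ k)).HasTemperateGrowth := fun t =>
    (Λ.packetPow_temperate hρ0 hρ t h).hasTemperateGrowth k
  -- Inserting `packetPow s * packetPow (-s) = 1` exhibits the result as `Λ^s` applied to a packet,
  -- which is what lets `J_{-s} u` reappear.
  have hinv : SchwartzMap.smulLeftCLM ℂ (Λ.packetPow ρ s (ξ₀ k))
      (SchwartzMap.smulLeftCLM ℂ (Λ.packetPow ρ (-s) (ξ₀ k)) (G k)) = G k := by
    ext η
    rw [SchwartzMap.smulLeftCLM_apply_apply (hp s), SchwartzMap.smulLeftCLM_apply_apply (hp _),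
      smul_smul, WeightFunction.packetPow, WeightFunction.packetPow, ← Complex.ofReal_mul,
      ← Real.rpow_add (div_pos (Λ.pos _) (Λ.pos _))]
    simp
  -- The powers of `Λ(ξ₀)` balance: `s - m` from the target space and `m` from the symbol against
  -- `s` from the source space. Hence no power of `Λ(ξ₀)` remains outside the packets.
  rw [hb, hb, hT, pseudoDiffDist, smulLeft_rescaledPow_packetOp hρ0 hρ _ _ (h k),
    smulLeft_rescaledPow_packetOp hρ0 hρ _ _ (h k), hinv, conj_formalAdjoint_conj hσ
      (g := ((Λ (ξ₀ k) ^ s : ℝ) : ℂ) • packetOp Λ ρ (x₀ k) (ξ₀ k) (G k)) fun ζ => ?_]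
  rw [smul_apply, hs, smul_eq_mul, mul_assoc,
    packetOp_oscInt hσ hρ0 hρ x₀ h _ G hG, ← integral_const_mul]
  refine integral_congr_ae (ae_of_all _ fun x => ?_)
  beta_reduce
  rw [FourierTransform.fourier_smul, smul_apply, smul_eq_mul]
  ring

end PacketPairing

/-! ### Asymptotics of wave packets -/

section Asymptotics

variable {n : ℕ} {Λ : WeightFunction n} {ρ m s : ℝ} {σ : Euc n → Euc n → ℂ}

/-- At the centre the normalized symbol is small by `h0`, and elsewhere it differs from that value
by `O(1/λ)` for fixed `y` and `η`. -/
theorem tendsto_packetSymbol (hσ : IsSymbolS Λ ρ m σ) (hρ0 : 0 < ρ) (hρ : ρ ≤ 1 / Λ.μ)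
    {x₀ ξ₀ : ℕ → Euc n} (h : ∀ k, 1 ≤ Λ (ξ₀ k)) (hΛ : Tendsto (fun k => Λ (ξ₀ k)) atTop atTop)
    (h0 : Tendsto (fun k => ‖σ (x₀ k) (ξ₀ k)‖ * Λ (ξ₀ k) ^ (-m)) atTop (𝓝 0)) (y η : Euc n) :
    Tendsto (fun k => packetSymbol Λ ρ m σ (x₀ k) (ξ₀ k) [] y η) atTop (𝓝 0) := by
  obtain ⟨N, C, hC, hb⟩ := packetSymbol_sub_le hσ hρ0 hρ
  have h1 : Tendsto (fun k => packetSymbol Λ ρ m σ (x₀ k) (ξ₀ k) [] 0 0) atTop (𝓝 0) := by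
    rw [tendsto_zero_iff_norm_tendsto_zero]
    refine h0.congr fun k => ?_
    have := Λ.pos (ξ₀ k)
    have := Λ.scale_pos ρ (ξ₀ k)
    rw [packetSymbol, norm_mul, Complex.norm_real, Real.norm_of_nonneg (by positivity)]
    simp [listPartial, mul_comm]
  have h2 : Tendsto (fun k => Λ.scale ρ (ξ₀ k)) atTop atTop :=
    (tendsto_rpow_atTop (by positivity)).comp hΛ
  have h3 : Tendsto (fun k => (Λ.scale ρ (ξ₀ k))⁻¹ * (C * (1 + ‖η‖) ^ N * (‖y‖ + ‖η‖)))
      atTop (𝓝 0) := by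
    simpa using h2.inv_tendsto_atTop.mul_const (C * (1 + ‖η‖) ^ N * (‖y‖ + ‖η‖))
  have h4 := squeeze_zero_norm (fun k => hb (x₀ k) (ξ₀ k) y η (h k)) h3
  simpa using h4.add h1

theorem tendsto_fourier {f : ℕ → 𝓢(Euc n, ℂ)} (hf : SchwartzBoundedBy (fun _ => 1) f)
    (h0 : ∀ x, Tendsto (fun k => f k x) atTop (𝓝 0)) (x : Euc n) :
    Tendsto (fun k => 𝓕 (f k) x) atTop (𝓝 0) := by
  have h1 := hf.tendsto_integral_rpow_norm (μ := volume) h0 (q := 1) le_rfl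
  simp only [Real.rpow_one] at h1
  refine squeeze_zero_norm (fun k => ?_) h1
  rw [fourier_eq_character]
  refine (norm_integral_le_integral_norm _).trans (le_of_eq ?_)
  simp only [norm_mul, norm_character, one_mul]

theorem tendsto_fourierInv {f : ℕ → 𝓢(Euc n, ℂ)} (hf : SchwartzBoundedBy (fun _ => 1) f)
    (h0 : ∀ x, Tendsto (fun k => f k x) atTop (𝓝 0)) (x : Euc n) :
    Tendsto (fun k => 𝓕⁻ (f k) x) atTop (𝓝 0) := by
  refine (tendsto_fourier hf h0 (-x)).congr fun k => ?_
  rw [SchwartzMap.fourierInv_coe, SchwartzMap.fourier_coe, Real.fourierInv_eq_fourier_neg]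

/-- If the symbol is not elliptic along the sequence `(x₀ k, ξ₀ k)`, then the transpose of `T` is
asymptotically small on the corresponding wave packets. -/
theorem exists_small_packets (hσ : IsSymbolS Λ ρ m σ) (hρ0 : 0 < ρ) (hρ : ρ ≤ 1 / Λ.μ)
    {p : ℝ≥0∞} [Fact (1 ≤ p)] {T : SobolevSpace Λ s p →L[ℂ] SobolevSpace Λ (s - m) p}
    (hT : IsPseudoDiffOn σ T) {x₀ ξ₀ : ℕ → Euc n} (h : ∀ k, 1 ≤ Λ (ξ₀ k))
    (hΛ : Tendsto (fun k => Λ (ξ₀ k)) atTop atTop)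
    (h0 : Tendsto (fun k => ‖σ (x₀ k) (ξ₀ k)‖ * Λ (ξ₀ k) ^ (-m)) atTop (𝓝 0))
    (Ψ : 𝓢(Euc n, ℂ)) : ∃ B : ℕ → 𝓢(Euc n, ℂ),
      (∀ (k : ℕ) (u : SobolevSpace Λ s p),
        besselJ Λ (-(s - m)) (SobolevSpace.toDistribution Λ (s - m) p (T u))
            (𝓕 (packetOp Λ ρ (x₀ k) (ξ₀ k) Ψ)) =
          besselJ Λ (-s) (SobolevSpace.toDistribution Λ s p u)
            (𝓕 (packetOp Λ ρ (x₀ k) (ξ₀ k) (B k)))) ∧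
      ∀ q : ℝ, 1 ≤ q → Tendsto (fun k => ∫ x, ‖𝓕 (B k) x‖ ^ q) atTop (𝓝 0) := by
  have hf : SchwartzBoundedBy (fun _ : ℕ => 1) fun k =>
      𝓕 (SchwartzMap.smulLeftCLM ℂ (Λ.packetPow ρ (s - m) (ξ₀ k)) Ψ) := by
    have := ((SchwartzBoundedBy.const Ψ).smulLeft
      (Λ.packetPow_temperate hρ0 hρ (s - m) h)).map (FourierTransform.fourierCLM ℂ 𝓢(Euc n, ℂ))
    simp only [mul_one] at this
    exact this
  have hA := isAmplitude_packetAmplitude hσ hρ0 hρ x₀ h hf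
  obtain ⟨G, hG, hGb⟩ := hA.exists_schwartz
  have hB : SchwartzBoundedBy (fun _ : ℕ => 1) fun k =>
      SchwartzMap.smulLeftCLM ℂ (Λ.packetPow ρ (-s) (ξ₀ k)) (G k) := by
    simpa only [mul_one] using hGb.smulLeft (Λ.packetPow_temperate hρ0 hρ (-s) h)
  -- The witness `B k` is `packetPow (-s)` times `G k`, as read off from `pairing_packet`.
  refine ⟨_, pairing_packet hσ hρ0 hρ hT x₀ h Ψ G hG, fun q hq => ?_⟩
  have hG0 : ∀ η, Tendsto (fun k => G k η) atTop (𝓝 0) := by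
    intro η
    simp only [hG, oscInt_eq_fourierInv]
    obtain ⟨N, hN⟩ := hA.bound []
    -- For fixed `η` the polynomial weight of the amplitude is a constant.
    have hb : SchwartzBoundedBy (fun _ : ℕ => 1) fun k =>
        packetAmplitude Λ ρ m σ x₀ ξ₀ (fun k =>
          𝓕 (SchwartzMap.smulLeftCLM ℂ (Λ.packetPow ρ (s - m) (ξ₀ k)) Ψ)) [] k η := by
      intro k l
      obtain ⟨C, hC⟩ := hN k l
      exact ⟨C * (1 + ‖η‖) ^ N, fun i => by simpa using hC (i, η)⟩
    refine tendsto_fourierInv hb (fun y => ?_) η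
    simp only [packetAmplitude_apply hσ hρ0 hρ x₀ h]
    obtain ⟨C, hC⟩ := hf.norm_le 0
    refine (tendsto_packetSymbol hσ hρ0 hρ h hΛ h0 y η).zero_mul_isBoundedUnder_le ?_
    refine isBoundedUnder_of ⟨C, fun k => ?_⟩
    simpa using hC k y
  have hB0 : ∀ η, Tendsto (fun k =>
      SchwartzMap.smulLeftCLM ℂ (Λ.packetPow ρ (-s) (ξ₀ k)) (G k) η) atTop (𝓝 0) := by
    intro η
    have ht := Λ.packetPow_temperate hρ0 hρ (-s) h
    obtain ⟨N, C, hC⟩ := ht.2 0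
    simp only [SchwartzMap.smulLeftCLM_apply_apply (ht.hasTemperateGrowth _), smul_eq_mul,
      mul_comm (WeightFunction.packetPow _ _ _ _ _)]
    refine (hG0 η).zero_mul_isBoundedUnder_le ?_
    refine isBoundedUnder_of ⟨C * (1 + ‖η‖) ^ N, fun k => ?_⟩
    simpa using hC k η
  exact (hB.map (FourierTransform.fourierCLM ℂ 𝓢(Euc n, ℂ))).tendsto_integral_rpow_norm
    (tendsto_fourier hB hB0) hq

end Asymptotics

/-! ### A singular sequence criterion -/

section Fredholm

variable {X Y : Type*} [NormedAddCommGroup X] [NormedSpace ℂ X] [NormedAddCommGroup Y]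
  [NormedSpace ℂ Y]

/-- If the functionals `φ k` tend to `0` pointwise, their image under the transpose of a Fredholm
operator tends to `0` in norm, and `y` is bounded, then `φ k (y k)` tends to `0`. -/
theorem tendsto_of_isFredholm {T : X →L[ℂ] Y} (hF : T.IsFredholm) {y : ℕ → Y} {M : ℝ}
    (hy : ∀ k, ‖y k‖ ≤ M) (φ : ℕ → Y →ₗ[ℂ] ℂ)
    (h0 : ∀ e, Tendsto (fun k => φ k e) atTop (𝓝 0)) {ε : ℕ → ℝ} (hε : Tendsto ε atTop (𝓝 0))
    (hT : ∀ k u, ‖φ k (T u)‖ ≤ ε k * ‖u‖) :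
    Tendsto (fun k => φ k (y k)) atTop (𝓝 0) := by
  -- Only the relation `T B = 1 + K` with `K` of finite rank is used: it writes `y k` as `T (B (y
  -- k)) - K (y k)`.
  obtain ⟨B, -, hB⟩ := hF.exists_isQuasiInverse
  have hK : ((T ∘L B - ContinuousLinearMap.id ℂ Y : Y →L[ℂ] Y) : Y →ₗ[ℂ] Y).HasFiniteRange :=
    LinearMap.FiniteRangeSetoid.equiv_iff_hasFiniteRange.1 hB
  set K : Y →L[ℂ] Y := T ∘L B - ContinuousLinearMap.id ℂ Y with hKdef
  have : FiniteDimensional ℂ (K : Y →ₗ[ℂ] Y).range :=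
    Module.Finite.iff_fg.2 (LinearMap.hasFiniteRange_iff_range.1 hK)
  let K' : Y →L[ℂ] (K : Y →ₗ[ℂ] Y).range := K.codRestrict _ fun v => ⟨v, rfl⟩
  let b := Module.finBasis ℂ (K : Y →ₗ[ℂ] Y).range
  have hKy : ∀ v, K v = ∑ i, b.equivFunL (K' v) i • (b i : Y) := fun v => by
    have h1 := congrArg (Submodule.subtype _) (b.sum_equivFun (K' v))
    simp only [map_sum, map_smul] at h1
    exact h1.symm
  have hdec : ∀ k, φ k (y k) = φ k (T (B (y k))) - ∑ i, b.equivFunL (K' (y k)) i * φ k (b i) := by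
    intro k
    have h1 : y k = T (B (y k)) - K (y k) := by simp [hKdef]
    conv_lhs => rw [h1, map_sub, hKy, map_sum]
    simp
  have hT0 : Tendsto (fun k => φ k (T (B (y k)))) atTop (𝓝 0) := by
    have h1 : Tendsto (fun k => |ε k| * (‖B‖ * M)) atTop (𝓝 0) := by
      simpa using hε.abs.mul_const (‖B‖ * M)
    refine squeeze_zero_norm (fun k => (hT k _).trans ?_) h1
    gcongr
    · exact le_abs_self _
    · exact (B.le_opNorm _).trans (by gcongr; exact hy k)
  -- The coordinates of `K (y k)` in a fixed finite basis stay bounded, while `φ k` tends to zero on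
  -- each basis vector; continuity of `φ k` is not required.
  have hS0 : ∀ i, Tendsto (fun k => b.equivFunL (K' (y k)) i * φ k (b i)) atTop (𝓝 0) := by
    intro i
    let ℓ : Y →L[ℂ] ℂ := ContinuousLinearMap.proj i ∘L b.equivFunL.toContinuousLinearMap ∘L K'
    simp only [mul_comm (b.equivFunL _ i)]
    refine (h0 _).zero_mul_isBoundedUnder_le ?_
    refine isBoundedUnder_of ⟨‖ℓ‖ * M, fun k => ?_⟩
    exact (ℓ.le_opNorm (y k)).trans (by gcongr; exact hy k)
  simp only [hdec]
  simpa using hT0.sub (tendsto_finsetSum _ fun i _ => hS0 i)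

end Fredholm

/-! ### The pairing of Schwartz functions with `L^p` functions -/

section Pairing

variable {n : ℕ} {p : ℝ≥0∞}

theorem norm_Lp_eq (hp : 1 < p) (hp' : p < ⊤) (w : Lp ℂ p (volume : Measure (Euc n))) :
    ‖w‖ = (∫ x, ‖w x‖ ^ p.toReal) ^ (1 / p.toReal) := by
  rw [Lp.norm_def, (Lp.memLp w).eLpNorm_eq_integral_rpow_norm (zero_lt_one.trans hp).ne' hp'.ne,
    ENNReal.toReal_ofReal (by positivity), one_div]

theorem norm_toLp_eq (hp : 1 < p) (hp' : p < ⊤) (f : 𝓢(Euc n, ℂ)) :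
    ‖f.toLp p volume‖ = (∫ x, ‖f x‖ ^ p.toReal) ^ (1 / p.toReal) := by
  rw [norm_Lp_eq hp hp']
  congr 1
  refine integral_congr_ae ?_
  filter_upwards [f.coeFn_toLp p volume] with x hx
  rw [hx]

variable [Fact (1 ≤ p)]

/-- The functional `w ↦ ∫ φ w` on `L^p`. -/
def lpPairing (p : ℝ≥0∞) [Fact (1 ≤ p)] (φ : 𝓢(Euc n, ℂ)) :
    Lp ℂ p (volume : Measure (Euc n)) →ₗ[ℂ] ℂ where
  toFun w := Lp.toTemperedDistributionCLM ℂ volume p w φ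
  map_add' v w := by rw [map_add]; rfl
  map_smul' c w := by rw [map_smul]; rfl

theorem lpPairing_apply (φ : 𝓢(Euc n, ℂ)) (w : Lp ℂ p (volume : Measure (Euc n))) :
    lpPairing p φ w = ∫ x, φ x * w x := by
  change Lp.toTemperedDistributionCLM ℂ volume p w φ = _
  rw [Lp.toTemperedDistributionCLM_apply, Lp.toTemperedDistribution_apply]
  rfl

theorem lpPairing_toLp (φ f : 𝓢(Euc n, ℂ)) :
    lpPairing p φ (f.toLp p volume) = ∫ x, φ x * f x := by
  rw [lpPairing_apply]
  refine integral_congr_ae ?_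
  filter_upwards [f.coeFn_toLp p volume] with x hx
  rw [hx]

theorem norm_lpPairing_le (hp' : p < ⊤) (hp : 1 < p) {q : ℝ} (hpq : p.toReal.HolderConjugate q)
    (φ : 𝓢(Euc n, ℂ)) (w : Lp ℂ p (volume : Measure (Euc n))) :
    ‖lpPairing p φ w‖ ≤ (∫ x, ‖φ x‖ ^ q) ^ (1 / q) * ‖w‖ := by
  rw [lpPairing_apply, norm_Lp_eq hp hp']
  refine (norm_integral_le_integral_norm _).trans ?_
  simp only [norm_mul]
  refine integral_mul_norm_le_Lp_mul_Lq hpq.symm (φ.memLp _ _) ?_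
  rw [ENNReal.ofReal_toReal hp'.ne]
  exact Lp.memLp w

theorem SobolevSpace.lpPairing_toLp_eq (Λ : WeightFunction n) (s : ℝ) (u : SobolevSpace Λ s p)
    (φ : 𝓢(Euc n, ℂ)) : lpPairing p φ (toLp Λ s p u) =
      besselJ Λ (-s) (toDistribution Λ s p u) φ := by
  rw [← toLp_spec]
  rfl

/-- The preimage is `J_s w`; this allows test vectors in the Sobolev space to be prescribed by their
`L^p` images. -/
theorem SobolevSpace.toLp_surjective (Λ : WeightFunction n) (s : ℝ) :
    Function.Surjective (toLp Λ s p) := by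
  intro w
  have h : besselJ Λ (-s) (besselJ Λ s (Lp.toTemperedDistribution w)) =
      Lp.toTemperedDistribution w := by
    simpa using besselJ_besselJ_neg Λ (-s) (Lp.toTemperedDistribution w)
  let u : SobolevSpace Λ s p := ⟨besselJ Λ s (Lp.toTemperedDistribution w), by
    rw [Submodule.mem_comap]
    exact ⟨w, h.symm⟩⟩
  refine ⟨u, ?_⟩
  have hinj := LinearMap.ker_eq_bot.1 (Lp.ker_toTemperedDistributionCLM_eq_bot
    (F := ℂ) (μ := (volume : Measure (Euc n))) (p := p))
  exact hinj ((toLp_spec Λ s p u).trans h)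

end Pairing

/-! ### Scaling of wave packets -/

section Scaling

variable {n : ℕ} {Λ : WeightFunction n} {ρ : ℝ}

/-- Amplitude `c^n` and width `1/c` give the power `n (1 - 1/q)`: no scaling in `L^1`, and `c^{n/p}`
in `L^q` when `q` is conjugate to `p`. -/
theorem integral_rpow_norm_fourier_packetOp (x₀ ξ₀ : Euc n) (f : 𝓢(Euc n, ℂ)) {q : ℝ}
    (hq : 1 ≤ q) : (∫ x, ‖𝓕 (packetOp Λ ρ x₀ ξ₀ f) x‖ ^ q) ^ (1 / q) =
      Λ.scale ρ ξ₀ ^ (n * (1 - 1 / q) : ℝ) * (∫ x, ‖𝓕 f x‖ ^ q) ^ (1 / q) := by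
  have hc := Λ.scale_pos ρ ξ₀
  have hq0 : q ≠ 0 := by linarith
  simp only [packetOp, norm_fourier_wavePacket]
  set c := Λ.scale ρ ξ₀
  have h1 : ∫ x, (c ^ n * ‖𝓕 f (c • (x - x₀))‖) ^ q =
      (c ^ (n * (1 - 1 / q) : ℝ)) ^ q * ∫ x, ‖𝓕 f x‖ ^ q := by
    rw [integral_sub_right_eq_self (fun x => (c ^ n * ‖𝓕 f (c • x)‖) ^ q) x₀]
    simp only [Real.mul_rpow (pow_nonneg hc.le n) (norm_nonneg _)]
    rw [integral_const_mul, Measure.integral_comp_smul_of_nonneg volume (fun x => ‖𝓕 f x‖ ^ q) c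
      (hR := hc.le), finrank_euclideanSpace_fin, smul_eq_mul, ← mul_assoc, ← Real.rpow_natCast,
      ← Real.rpow_mul hc.le, ← Real.rpow_neg hc.le, ← Real.rpow_add hc, ← Real.rpow_mul hc.le]
    congr 2
    field_simp
    ring
  rw [h1, Real.mul_rpow (by positivity) (by positivity), ← Real.rpow_mul (by positivity) q,
    mul_one_div_cancel hq0, Real.rpow_one]

/-- Normalized wave packets converge weakly to `0` in the dual of `L^p`. -/
theorem tendsto_lpPairing_packetOp (hn : n ≠ 0) {p : ℝ≥0∞} [Fact (1 ≤ p)] (hp : 1 < p)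
    (hp' : p < ⊤) {x₀ ξ₀ : ℕ → Euc n} (hΛ : Tendsto (fun k => Λ.scale ρ (ξ₀ k)) atTop atTop)
    (Ψ : 𝓢(Euc n, ℂ)) (w : Lp ℂ p (volume : Measure (Euc n))) :
    Tendsto (fun k => Λ.scale ρ (ξ₀ k) ^ (-(n / p.toReal) : ℝ) *
      ‖lpPairing p (𝓕 (packetOp Λ ρ (x₀ k) (ξ₀ k) Ψ)) w‖) atTop (𝓝 0) := by
  have hp1 : 1 < p.toReal := by
    rw [← ENNReal.toReal_one]
    exact (ENNReal.toReal_lt_toReal ENNReal.one_ne_top hp'.ne).2 hp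
  have hpq := Real.HolderConjugate.conjExponent hp1
  set q := p.toReal.conjExponent
  have hs : ∀ k, 0 < Λ.scale ρ (ξ₀ k) := fun k => Λ.scale_pos ρ (ξ₀ k)
  set A := (∫ x, ‖𝓕 Ψ x‖ ^ q) ^ (1 / q) with hA
  have hA0 : 0 ≤ A := by positivity
  have hbound : ∀ k (v : Lp ℂ p (volume : Measure (Euc n))),
      Λ.scale ρ (ξ₀ k) ^ (-(n / p.toReal) : ℝ) *
        ‖lpPairing p (𝓕 (packetOp Λ ρ (x₀ k) (ξ₀ k) Ψ)) v‖ ≤ A * ‖v‖ := by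
    intro k v
    have h1 := norm_lpPairing_le hp' hp hpq (𝓕 (packetOp Λ ρ (x₀ k) (ξ₀ k) Ψ)) v
    rw [integral_rpow_norm_fourier_packetOp _ _ _ hpq.symm.lt.le, ← hA, one_div,
      hpq.symm.one_sub_inv, ← div_eq_mul_inv] at h1
    refine (mul_le_mul_of_nonneg_left h1 (Real.rpow_nonneg (hs k).le _)).trans (le_of_eq ?_)
    rw [← mul_assoc, ← mul_assoc, ← Real.rpow_add (hs k), neg_add_cancel, Real.rpow_zero, one_mul]
  rw [Metric.tendsto_atTop]
  intro δ hδ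
  -- By the uniform bound `hbound`, convergence has to be checked only on a dense subspace; the `+
  -- 1` covers the case `A = 0`.
  obtain ⟨θ, hθ⟩ := (SchwartzMap.denseRange_toLpCLM (E := Euc n) (F := ℂ)
    (μ := volume) hp'.ne).exists_dist_lt w (ε := δ / (2 * (A + 1))) (by positivity)
  obtain ⟨D, hD⟩ : ∃ D, ∀ x, ‖θ x‖ ≤ D :=
    ⟨SchwartzMap.seminorm ℂ 0 0 θ, fun x => by simpa using θ.le_seminorm ℂ 0 0 x⟩
  -- Against a bounded function the pairing is controlled by the `L^1` norm of the packet, which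
  -- does not depend on `k`, so the factor `λ^{-n/p}` alone forces convergence. This needs `n ≠ 0`.
  have hsmall : Tendsto (fun k => Λ.scale ρ (ξ₀ k) ^ (-(n / p.toReal) : ℝ) *
      ((∫ x, ‖𝓕 Ψ x‖) * D)) atTop (𝓝 0) := by
    have h1 : (0 : ℝ) < n / p.toReal := by
      have : (0 : ℝ) < n := by exact_mod_cast Nat.pos_of_ne_zero hn
      positivity
    simpa using ((tendsto_rpow_neg_atTop h1).comp hΛ).mul_const ((∫ x, ‖𝓕 Ψ x‖) * D)
  obtain ⟨k₀, hk₀⟩ := (Metric.tendsto_atTop.1 hsmall) (δ / 2) (by positivity)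
  refine ⟨k₀, fun k hk => ?_⟩
  have h1 := hbound k (w - θ.toLp p volume)
  have h2 : ‖lpPairing p (𝓕 (packetOp Λ ρ (x₀ k) (ξ₀ k) Ψ)) (θ.toLp p volume)‖ ≤
      (∫ x, ‖𝓕 Ψ x‖) * D := by
    rw [lpPairing_toLp]
    have h3 := integral_rpow_norm_fourier_packetOp (Λ := Λ) (ρ := ρ) (x₀ k) (ξ₀ k) Ψ le_rfl
    simp only [div_one, sub_self, mul_zero, Real.rpow_zero, Real.rpow_one, one_mul] at h3
    rw [← h3, ← integral_mul_const]
    refine (norm_integral_le_integral_norm _).trans (integral_mono_of_nonneg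
      (ae_of_all _ fun x => norm_nonneg _) ?_ (ae_of_all _ fun x => ?_))
    · exact (SchwartzMap.integrable _).norm.mul_const D
    · beta_reduce
      rw [norm_mul]
      gcongr
      exact hD x
  have h4 := hk₀ k hk
  rw [dist_zero_right] at h4 ⊢
  have hr := Real.rpow_nonneg (hs k).le (-(n / p.toReal) : ℝ)
  rw [Real.norm_of_nonneg (by positivity)]
  rw [dist_eq_norm] at hθ
  have h5 : A * ‖w - θ.toLp p volume‖ < δ / 2 := by
    calc A * ‖w - θ.toLp p volume‖ ≤ A * (δ / (2 * (A + 1))) := by gcongr; exact hθ.le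
      _ < (A + 1) * (δ / (2 * (A + 1))) := by gcongr; linarith
      _ = δ / 2 := by field_simp
  have h6 : w = (w - θ.toLp p volume) + θ.toLp p volume := (sub_add_cancel _ _).symm
  rw [h6, map_add]
  calc _ ≤ Λ.scale ρ (ξ₀ k) ^ (-(n / p.toReal) : ℝ) *
        (‖lpPairing p (𝓕 (packetOp Λ ρ (x₀ k) (ξ₀ k) Ψ)) (w - θ.toLp p volume)‖ +
          (∫ x, ‖𝓕 Ψ x‖) * D) := by
        gcongr
        exact (norm_add_le _ _).trans (by gcongr)
    _ < δ := by
        rw [mul_add]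
        have := (le_abs_self _).trans_lt h4
        linarith

end Scaling

/-! ### The contradiction along a degenerating sequence -/

theorem exists_schwartz_integral_pos (n : ℕ) : ∃ Θ : 𝓢(Euc n, ℂ), 0 < ∫ x, ‖Θ x‖ ^ (2 : ℝ) := by
  let b : ContDiffBump (0 : Euc n) := ⟨1, 2, one_pos, one_lt_two⟩
  have hb : HasCompactSupport fun x => (b x : ℂ) :=
    b.hasCompactSupport.comp_left (g := fun t : ℝ => (t : ℂ)) Complex.ofReal_zero
  have hs : ContDiff ℝ ∞ fun x => (b x : ℂ) := Complex.ofRealCLM.contDiff.comp b.contDiff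
  refine ⟨hb.toSchwartzMap hs, ?_⟩
  have h0 : b 0 = 1 := b.one_of_mem_closedBall (by simp [b])
  refine Continuous.integral_pos_of_hasCompactSupport_nonneg_nonzero (x := 0) ?_ ?_ ?_ ?_
  · exact (SchwartzMap.continuous _).norm.rpow_const fun _ => Or.inr zero_le_two
  · exact hb.comp_left (g := fun z : ℂ => ‖z‖ ^ (2 : ℝ)) (by simp)
  · exact fun x => by positivity
  · simp [h0]

theorem WeightFunction.exists_le_of_le_norm {n : ℕ} (Λ : WeightFunction n) (M : ℝ) :
    ∃ R : ℝ, 0 < R ∧ ∀ ξ, R ≤ ‖ξ‖ → M ≤ Λ ξ := by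
  obtain ⟨μ₀, μ₁, C₀, C₁, h0, -, hC0, -, -, h⟩ := Λ.growth
  have ht : Tendsto (fun r : ℝ => C₀ * (1 + r) ^ μ₀) atTop atTop :=
    ((tendsto_rpow_atTop h0).comp (tendsto_atTop_add_const_left _ 1 tendsto_id)).const_mul_atTop hC0
  obtain ⟨R, hR⟩ := (tendsto_atTop.1 ht M).exists_forall_of_atTop
  exact ⟨max R 1, by positivity, fun ξ hξ => (hR _ ((le_max_left _ _).trans hξ)).trans (h ξ).1⟩

/-- A Fredholm pseudo-differential operator does not have a sequence of points, tending to infinity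
in frequency, along which its symbol degenerates. -/
theorem not_tendsto_of_isFredholm {n : ℕ} (hn : n ≠ 0) {Λ : WeightFunction n} {ρ m s : ℝ}
    {σ : Euc n → Euc n → ℂ} (hσ : IsSymbolS Λ ρ m σ) (hρ0 : 0 < ρ) (hρ : ρ ≤ 1 / Λ.μ)
    {p : ℝ≥0∞} [Fact (1 ≤ p)] (hp : 1 < p) (hp' : p < ⊤)
    {T : SobolevSpace Λ s p →L[ℂ] SobolevSpace Λ (s - m) p} (hT : IsPseudoDiffOn σ T)
    (hF : T.IsFredholm) {x₀ ξ₀ : ℕ → Euc n} (h : ∀ k, 1 ≤ Λ (ξ₀ k))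
    (hΛ : Tendsto (fun k => Λ (ξ₀ k)) atTop atTop) :
    ¬ Tendsto (fun k => ‖σ (x₀ k) (ξ₀ k)‖ * Λ (ξ₀ k) ^ (-m)) atTop (𝓝 0) := by
  intro h0
  have hp1 : 1 < p.toReal := by
    rw [← ENNReal.toReal_one]
    exact (ENNReal.toReal_lt_toReal ENNReal.one_ne_top hp'.ne).2 hp
  have hpq := Real.HolderConjugate.conjExponent hp1
  set q := p.toReal.conjExponent
  have hs : ∀ k, 0 < Λ.scale ρ (ξ₀ k) := fun k => Λ.scale_pos ρ (ξ₀ k)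
  have hsc : Tendsto (fun k => Λ.scale ρ (ξ₀ k)) atTop atTop :=
    (tendsto_rpow_atTop (by positivity)).comp hΛ
  obtain ⟨Θ, hΘ⟩ := exists_schwartz_integral_pos n
  -- All norms of packets involve `𝓕 Ψ` only, so `𝓕 Ψ` is what has to be chosen nonzero.
  obtain ⟨Ψ, rfl⟩ : ∃ Ψ : 𝓢(Euc n, ℂ), 𝓕 Ψ = Θ := ⟨𝓕⁻ Θ, by simp⟩
  obtain ⟨B, hB, hBq⟩ := exists_small_packets hσ hρ0 hρ hT h hΛ h0 Ψ
  set ψ : ℕ → 𝓢(Euc n, ℂ) := fun k => 𝓕 (packetOp Λ ρ (x₀ k) (ξ₀ k) Ψ) with hψ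
  have hnorm : ∀ k (f : 𝓢(Euc n, ℂ)) (t : ℝ) {r r' : ℝ} (_ : r.HolderConjugate r'),
      Λ.scale ρ (ξ₀ k) ^ (-(n / r') : ℝ) *
        ((∫ x, ‖𝓕 (packetOp Λ ρ (x₀ k) (ξ₀ k) f) x‖ ^ r) ^ (1 / r) * t) =
      (∫ x, ‖𝓕 f x‖ ^ r) ^ (1 / r) * t := by
    intro k f t r r' hr
    rw [integral_rpow_norm_fourier_packetOp _ _ _ hr.lt.le, one_div, hr.one_sub_inv,
      ← div_eq_mul_inv, ← mul_assoc, ← mul_assoc, ← Real.rpow_add (hs k), neg_add_cancel,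
      Real.rpow_zero, one_mul]
  have hnr : ∀ k (t : ℝ), ‖((Λ.scale ρ (ξ₀ k) ^ t : ℝ) : ℂ)‖ = Λ.scale ρ (ξ₀ k) ^ t := fun k t => by
    rw [Complex.norm_real, Real.norm_of_nonneg (Real.rpow_nonneg (hs k).le t)]
  -- The test vectors are the conjugate packets, normalized in `L^p` by `λ^{-n/q}`, while `φ k` is
  -- normalized in `L^q` by `λ^{-n/p}`.
  choose y hy using fun k => SobolevSpace.toLp_surjective (p := p) Λ (s - m)
    (((Λ.scale ρ (ξ₀ k) ^ (-(n / q) : ℝ) : ℝ) : ℂ) • (schwartzConj (ψ k)).toLp p volume)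
  let φ : ℕ → SobolevSpace Λ (s - m) p →ₗ[ℂ] ℂ := fun k =>
    ((Λ.scale ρ (ξ₀ k) ^ (-(n / p.toReal) : ℝ) : ℝ) : ℂ) •
      (lpPairing p (ψ k) ∘ₗ SobolevSpace.toLp Λ (s - m) p)
  have hφ : ∀ k v, φ k v = ((Λ.scale ρ (ξ₀ k) ^ (-(n / p.toReal) : ℝ) : ℝ) : ℂ) *
      lpPairing p (ψ k) (SobolevSpace.toLp Λ (s - m) p v) := fun k v => rfl
  have hyM : ∀ k, ‖y k‖ ≤ (∫ x, ‖𝓕 Ψ x‖ ^ p.toReal) ^ (1 / p.toReal) := by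
    intro k
    change ‖SobolevSpace.toLp Λ (s - m) p (y k)‖ ≤ _
    rw [hy, norm_smul, hnr, norm_toLp_eq hp hp']
    simp only [schwartzConj_apply, RCLike.norm_conj]
    have := hnorm k Ψ 1 hpq
    simp only [mul_one] at this
    exact this.le
  have hφT : ∀ k u, ‖φ k (T u)‖ ≤ (∫ x, ‖𝓕 (B k) x‖ ^ q) ^ (1 / q) * ‖u‖ := by
    intro k u
    rw [hφ, SobolevSpace.lpPairing_toLp_eq, hψ, hB, ← SobolevSpace.lpPairing_toLp_eq, norm_mul, hnr,
      ← hnorm k (B k) ‖u‖ hpq.symm]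
    gcongr
    · exact Real.rpow_nonneg (hs k).le _
    · exact norm_lpPairing_le hp' hp hpq _ _
  have hε : Tendsto (fun k => (∫ x, ‖𝓕 (B k) x‖ ^ q) ^ (1 / q)) atTop (𝓝 0) := by
    have := (hBq q hpq.symm.lt.le).rpow_const (p := 1 / q) (Or.inr hpq.symm.one_div_nonneg)
    rwa [Real.zero_rpow hpq.symm.one_div_ne_zero] at this
  have hφ0 : ∀ e, Tendsto (fun k => φ k e) atTop (𝓝 0) := by
    intro e
    rw [tendsto_zero_iff_norm_tendsto_zero]
    refine (tendsto_lpPairing_packetOp (x₀ := x₀) hn hp hp' hsc Ψ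
      (SobolevSpace.toLp Λ (s - m) p e)).congr fun k => ?_
    rw [hφ, norm_mul, hnr]
  -- The factor `λ^n` from the squared `L²` norm cancels both normalizations because `1/p + 1/q =
  -- 1`, so the pairing does not depend on `k`.
  have hφy : ∀ k, φ k (y k) = ((∫ x, ‖𝓕 Ψ x‖ ^ (2 : ℝ) : ℝ) : ℂ) := by
    intro k
    have h1 : ∫ x, ψ k x * schwartzConj (ψ k) x = ((∫ x, ‖ψ k x‖ ^ (2 : ℝ) : ℝ) : ℂ) := by
      rw [← integral_complex_ofReal]
      refine integral_congr_ae (ae_of_all _ fun x => ?_)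
      beta_reduce
      rw [schwartzConj_apply, Complex.mul_conj, Complex.normSq_eq_norm_sq]
      norm_cast
    have h2 : ∫ x, ‖ψ k x‖ ^ (2 : ℝ) = Λ.scale ρ (ξ₀ k) ^ (n : ℝ) * ∫ x, ‖𝓕 Ψ x‖ ^ (2 : ℝ) := by
      have h3 := integral_rpow_norm_fourier_packetOp (Λ := Λ) (ρ := ρ) (x₀ k) (ξ₀ k) Ψ one_le_two
      have h4 := congrArg (fun t : ℝ => t ^ (2 : ℝ)) h3
      simp only [Real.mul_rpow (Real.rpow_nonneg (hs k).le _) (Real.rpow_nonneg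
        (integral_nonneg fun x => Real.rpow_nonneg (norm_nonneg (𝓕 Ψ x)) 2) _)] at h4
      rw [← Real.rpow_mul (hs k).le, ← Real.rpow_mul (by positivity),
        ← Real.rpow_mul (by positivity), show (n : ℝ) * (1 - 1 / 2) * 2 = n by ring] at h4
      norm_num at h4
      exact_mod_cast h4
    rw [hφ, hy, map_smul, lpPairing_toLp, h1, h2, smul_eq_mul, ← Complex.ofReal_mul,
      ← Complex.ofReal_mul, ← mul_assoc, ← mul_assoc, ← Real.rpow_add (hs k),
      ← Real.rpow_add (hs k)]
    have : -((n : ℝ) / p.toReal) + -(n / q) + n = 0 := by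
      have := hpq.inv_add_inv_eq_one
      rw [div_eq_mul_inv, div_eq_mul_inv]
      linear_combination (-(n : ℝ)) * this
    rw [this, Real.rpow_zero, one_mul]
  have hlim := tendsto_of_isFredholm hF hyM φ hφ0 hε hφT
  simp only [hφy] at hlim
  have := tendsto_nhds_unique tendsto_const_nhds hlim
  exact hΘ.ne' (by exact_mod_cast this)

end MPseudo

end

theorem mainTheorem2 {n : ℕ} (Λ : MPseudo.WeightFunction n) (ρ : ℝ) (hρ : 0 < ρ) (hρμ : ρ ≤ 1 / Λ.μ)
    (p : ℝ≥0∞) [Fact (1 ≤ p)] (hp : 1 < p) (hp' : p < ⊤) (m : ℝ)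
    (σ : MPseudo.Euc n → MPseudo.Euc n → ℂ) (hσ : MPseudo.IsSymbolM Λ ρ m σ) (s : ℝ)
    (T : MPseudo.SobolevSpace Λ s p →L[ℂ] MPseudo.SobolevSpace Λ (s - m) p)
    (hT : MPseudo.IsPseudoDiffOn σ T) (hF : T.IsFredholm) :
    MPseudo.IsMElliptic Λ m σ := by
  -- In dimension zero no `ξ` satisfies `‖ξ‖ ≥ 1`, so ellipticity is vacuous.
  rcases eq_or_ne n 0 with rfl | hn
  · refine ⟨1, 1, one_pos, one_pos, fun x ξ hξ => ?_⟩
    rw [Subsingleton.elim ξ 0, norm_zero] at hξ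
    exact absurd hξ (by norm_num)
  by_contra hne
  -- Ellipticity is denied with the constant `1/(k+1)` and with a radius beyond which `Λ ≥ k + 1`,
  -- so the points found also tend to infinity in the weight.
  have hseq : ∀ k : ℕ, ∃ x ξ, (k : ℝ) + 1 ≤ Λ ξ ∧ ‖σ x ξ‖ < 1 / ((k : ℝ) + 1) * Λ ξ ^ m := by
    intro k
    obtain ⟨R, hR, hΛR⟩ := Λ.exists_le_of_le_norm ((k : ℝ) + 1)
    by_contra! hk
    refine hne ⟨1 / ((k : ℝ) + 1), R, by positivity, hR, fun x ξ hξ => hk x ξ (hΛR ξ hξ)⟩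
  choose x₀ ξ₀ hξ₀ hlt using hseq
  refine MPseudo.not_tendsto_of_isFredholm hn hσ.isSymbolS hρ hρμ hp hp' hT hF (x₀ := x₀) (ξ₀ := ξ₀)
    (fun k => le_trans (by simp) (hξ₀ k)) (Filter.tendsto_atTop_mono hξ₀
      (Filter.tendsto_atTop_add_const_right _ 1 tendsto_natCast_atTop_atTop)) ?_
  refine squeeze_zero (fun k => ?_) (fun k => ?_) tendsto_one_div_add_atTop_nhds_zero_nat
  · exact mul_nonneg (norm_nonneg _) (Real.rpow_nonneg (Λ.pos _).le _)
  · have h1 := Real.rpow_pos_of_pos (Λ.pos (ξ₀ k)) m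
    rw [Real.rpow_neg (Λ.pos _).le, ← div_eq_mul_inv, div_le_iff₀ h1]
    exact (hlt k).le
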